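/- Let $g$ be the round metric of constant sectional curvature $3$ on the sphere $S^2$ (one third of the metric of the unit sphere in $\mathbb{R}^3$) and let $h$ be the round metric of constant sectional curvature $1$ on $S^4$ (the metric of the unit sphere in $\mathbb{R}^5$). For a closed Riemannian six-manifold $(M,\gamma)$ let $$\mathcal{L}_1(M,\gamma) := \int_M \Bigl( 2\Delta|W|^2 - 48\nabla^l(W_{ijkl}C^{ijk}) + |\nabla W|^2 + 48P_t^sW_{sijk}W^{tijk} - 8J|W|^2 - 64|C|^2 \Bigr)\,d\mathrm{vol}_\gamma ,$$ where, $R_{ijkl}$ and $R_{ij}$ being the Riemann and Ricci tensors of $\gamma$ (with $R_{ijkl} = K(\gamma_{ik}\gamma_{jl} - \gamma_{il}\gamma_{jk})$ in constant sectional curvature $K$) and $R$ the scalar curvature, $J := \frac{1}{10}R$, $P_{ij} := \frac14(R_{ij} - J\gamma_{ij})$ is the Schouten tensor, $W_{ijkl} := R_{ijkl} - P_{ik}\gamma_{jl} - P_{jl}\gamma_{ik} + P_{il}\gamma_{jk} + P_{jk}\gamma_{il}$ is the Weyl tensor, $C_{ijk} := \nabla_iP_{jk} - \nabla_jP_{ik}$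 is the Cotton tensor, $\Delta := \nabla^i\nabla_i$, and norms are full contractions, e.g. $|W|^2 = W_{ijkl}W^{ijkl}$. Then $$\mathcal{L}_1(S^2\times S^4, g + c\,h) = 128\pi^3c^{-1}(3c+1)^2(c-1) \qquad\text{for all } c > 0 .$$ Moreover, the product metric $g + h$ is Einstein, and it is not a critical point of $\mathcal{L}_1$ on the space of Riemannian metrics on $S^2\times S^4$: there is a smooth symmetric $2$-tensor field $k$ for which $\frac{d}{dt}\big|_{t=0}\mathcal{L}_1(S^2\times S^4, g + h + tk)$ exists and is nonzero. -/

import Mathlib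

open Bundle Manifold MeasureTheory
open scoped ContDiff

noncomputable section

/-! ### Riemannian geometry in coordinates

`E` is a finite-dimensional real vector space with a basis `b`, whose dual basis gives linear
coordinates on `E`.  A covariant tensor field of rank `k` on (an open part of) `E` is given by its
components, a function `E → ι → ⋯ → ι → ℝ`.  In particular a metric is `G : E → ι → ι → ℝ`. -/

namespace LocalGeometry

variable {E ι : Type*} [NormedAddCommGroup E] [NormedSpace ℝ E] [Fintype ι]

/-- The partial derivative `∂ᵢ f`. -/
def pd (b : Module.Basis ι ℝ E) (i : ι) (f : E → ℝ) (y : E) : ℝ := fderiv ℝ f y (b i)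

/-- Complete contraction `g^{ia} Sᵢ Tₐ` (here `g` holds the components of the inverse metric). -/
def inner1 (g : ι → ι → ℝ) (S T : ι → ℝ) : ℝ := ∑ i, ∑ a, g i a * (S i * T a)

/-- Complete contraction `S_{ij} T^{ij}`. -/
def inner2 (g : ι → ι → ℝ) (S T : ι → ι → ℝ) : ℝ := ∑ i, ∑ a, g i a * inner1 g (S i) (T a)

/-- Complete contraction `S_{ijk} T^{ijk}`. -/
def inner3 (g : ι → ι → ℝ) (S T : ι → ι → ι → ℝ) : ℝ := ∑ i, ∑ a, g i a * inner2 g (S i) (T a)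

/-- Complete contraction `S_{ijkl} T^{ijkl}`. -/
def inner4 (g : ι → ι → ℝ) (S T : ι → ι → ι → ι → ℝ) : ℝ :=
  ∑ i, ∑ a, g i a * inner3 g (S i) (T a)

/-- Complete contraction `S_{ijklm} T^{ijklm}`. -/
def inner5 (g : ι → ι → ℝ) (S T : ι → ι → ι → ι → ι → ℝ) : ℝ :=
  ∑ i, ∑ a, g i a * inner4 g (S i) (T a)

variable [DecidableEq ι]

/-- The components `g^{ij}` of the inverse metric. -/
def inv (G : E → ι → ι → ℝ) (y : E) : ι → ι → ℝ := fun i j => (Matrix.of (G y))⁻¹ i j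

/-- The Christoffel symbols `Γ^k_{ij}` of the Levi-Civita connection; `k` is the first argument. -/
def christoffel (b : Module.Basis ι ℝ E) (G : E → ι → ι → ℝ) (k i j : ι) (y : E) : ℝ :=
  (1 / 2) * ∑ l, inv G y k l *
    (pd b i (fun z => G z j l) y + pd b j (fun z => G z i l) y - pd b l (fun z => G z i j) y)

/-- `R^i_{jkl}`, defined by `R(∂ₖ, ∂ₗ) ∂ⱼ = R^i_{jkl} ∂ᵢ` with
`R(X, Y) = [∇_X, ∇_Y] - ∇_{[X, Y]}`. -/
def riemannUp (b : Module.Basis ι ℝ E) (G : E → ι → ι → ℝ) (y : E) (i j k l : ι) : ℝ :=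
  pd b k (christoffel b G i l j) y - pd b l (christoffel b G i k j) y
    + ∑ s, (christoffel b G i k s y * christoffel b G s l j y
      - christoffel b G i l s y * christoffel b G s k j y)

/-- The Riemann tensor `R_{ijkl}`; on a space of constant sectional curvature `K` it is
`K (g_{ik} g_{jl} - g_{il} g_{jk})`. -/
def riemann (b : Module.Basis ι ℝ E) (G : E → ι → ι → ℝ) (y : E) (i j k l : ι) : ℝ :=
  ∑ s, G y i s * riemannUp b G y s j k l

/-- The Ricci tensor `R_{ij}`. -/
def ricci (b : Module.Basis ι ℝ E) (G : E → ι → ι → ℝ) (y : E) (i j : ι) : ℝ :=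
  ∑ s, riemannUp b G y s i s j

/-- The scalar curvature. -/
def scalarCurv (b : Module.Basis ι ℝ E) (G : E → ι → ι → ℝ) (y : E) : ℝ :=
  ∑ i, ∑ j, inv G y i j * ricci b G y i j

/-- `J`, the trace of the Schouten tensor, which is `R / (2 (n - 1))` in dimension `n`. -/
def schoutenTrace (b : Module.Basis ι ℝ E) (G : E → ι → ι → ℝ) (y : E) : ℝ :=
  scalarCurv b G y / (2 * ((Fintype.card ι : ℝ) - 1))

/-- The Schouten tensor `P_{ij} = (R_{ij} - J g_{ij}) / (n - 2)`. -/
def schouten (b : Module.Basis ι ℝ E) (G : E → ι → ι → ℝ) (y : E) (i j : ι) : ℝ :=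
  (ricci b G y i j - schoutenTrace b G y * G y i j) / ((Fintype.card ι : ℝ) - 2)

/-- The Weyl tensor `W_{ijkl}`. -/
def weyl (b : Module.Basis ι ℝ E) (G : E → ι → ι → ℝ) (y : E) (i j k l : ι) : ℝ :=
  riemann b G y i j k l - schouten b G y i k * G y j l - schouten b G y j l * G y i k
    + schouten b G y i l * G y j k + schouten b G y j k * G y i l

/-- `∇ₐ Tᵢ`. -/
def covDeriv1 (b : Module.Basis ι ℝ E) (G : E → ι → ι → ℝ) (T : E → ι → ℝ) (y : E)
    (a i : ι) : ℝ :=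
  pd b a (fun z => T z i) y - ∑ s, christoffel b G s a i y * T y s

/-- `∇ₐ T_{ij}`. -/
def covDeriv2 (b : Module.Basis ι ℝ E) (G : E → ι → ι → ℝ) (T : E → ι → ι → ℝ) (y : E)
    (a i j : ι) : ℝ :=
  pd b a (fun z => T z i j) y
    - ∑ s, (christoffel b G s a i y * T y s j + christoffel b G s a j y * T y i s)

/-- `∇ₐ T_{ijkl}`. -/
def covDeriv4 (b : Module.Basis ι ℝ E) (G : E → ι → ι → ℝ) (T : E → ι → ι → ι → ι → ℝ) (y : E)
    (a i j k l : ι) : ℝ :=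
  pd b a (fun z => T z i j k l) y
    - ∑ s, (christoffel b G s a i y * T y s j k l + christoffel b G s a j y * T y i s k l
      + christoffel b G s a k y * T y i j s l + christoffel b G s a l y * T y i j k s)

/-- The divergence `∇^i Tᵢ`. -/
def divergence (b : Module.Basis ι ℝ E) (G : E → ι → ι → ℝ) (T : E → ι → ℝ) (y : E) : ℝ :=
  ∑ a, ∑ i, inv G y a i * covDeriv1 b G T y a i

/-- The Laplacian `Δ f = ∇^i ∇ᵢ f`. -/
def laplacian (b : Module.Basis ι ℝ E) (G : E → ι → ι → ℝ) (f : E → ℝ) (y : E) : ℝ :=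
  divergence b G (fun z i => pd b i f z) y

/-- The Cotton tensor `C_{ijk} = ∇ᵢ P_{jk} - ∇ⱼ P_{ik}`. -/
def cotton (b : Module.Basis ι ℝ E) (G : E → ι → ι → ℝ) (y : E) (i j k : ι) : ℝ :=
  covDeriv2 b G (schouten b G) y i j k - covDeriv2 b G (schouten b G) y j i k

/-- `|W|² = W_{ijkl} W^{ijkl}`. -/
def weylNormSq (b : Module.Basis ι ℝ E) (G : E → ι → ι → ℝ) (y : E) : ℝ :=
  inner4 (inv G y) (weyl b G y) (weyl b G y)

/-- The scalar invariant
`L₁ = 2 Δ|W|² - 48 ∇^l (W_{ijkl} C^{ijk}) + |∇W|² + 48 P_t^s W_{sijk} W^{tijk} - 8 J |W|²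
  - 64 |C|²`. -/
def L1 (b : Module.Basis ι ℝ E) (G : E → ι → ι → ℝ) (y : E) : ℝ :=
  2 * laplacian b G (weylNormSq b G) y
    - 48 * divergence b G
        (fun z l => inner3 (inv G z) (fun i j k => weyl b G z i j k l) (cotton b G z)) y
    + inner5 (inv G y) (covDeriv4 b G (weyl b G) y) (covDeriv4 b G (weyl b G) y)
    + 48 * inner2 (inv G y) (schouten b G y)
        (fun s t => inner3 (inv G y) (weyl b G y s) (weyl b G y t))
    - 8 * schoutenTrace b G y * weylNormSq b G y
    - 64 * inner3 (inv G y) (cotton b G y) (cotton b G y)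

end LocalGeometry

/-! ### Riemannian geometry on manifolds -/

namespace RiemGeometry

section

variable {E H : Type*} [NormedAddCommGroup E] [NormedSpace ℝ E] [TopologicalSpace H]
  (I : ModelWithCorners ℝ E H) (M : Type*) [TopologicalSpace M] [ChartedSpace H M]

/-- Fields of bilinear forms on the tangent spaces of `M`. -/
abbrev BilinField : Type _ := (p : M) → TangentSpace I p →L[ℝ] TangentSpace I p →L[ℝ] ℝ

variable {I M}

/-- Smoothness of a field of bilinear forms, as a section of the bundle of bilinear forms. -/
def BilinField.IsSmooth [IsManifold I 1 M] (k : BilinField I M) : Prop :=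
  ContMDiff I (I.prod 𝓘(ℝ, E →L[ℝ] E →L[ℝ] ℝ)) ∞
    (fun p => TotalSpace.mk' (E →L[ℝ] E →L[ℝ] ℝ) p (k p))

/-- `g` is a smooth Riemannian metric on `M`. -/
def BilinField.IsRiemannian [IsManifold I 1 M] (g : BilinField I M) : Prop :=
  ∃ γ : ContMDiffRiemannianMetric I ∞ E (fun p : M => TangentSpace I p), γ.inner = g

variable {ι : Type*} (b : Module.Basis ι ℝ E)

/-- The components of `g` in the chart of `M` around `x` (composed with the linear coordinates
given by `b`), at a point `y` of the target of this chart: `gᵢⱼ = g(∂ᵢ, ∂ⱼ)`, where the coordinate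
vector `∂ᵢ` is the image of `b i` under the differential of the inverse chart. -/
def chartMetric (g : BilinField I M) (x : M) (y : E) (i j : ι) : ℝ :=
  g ((extChartAt I x).symm y)
    (mfderiv 𝓘(ℝ, E) I (extChartAt I x).symm y (b i))
    (mfderiv 𝓘(ℝ, E) I (extChartAt I x).symm y (b j))

variable [Fintype ι] [DecidableEq ι]

/-- The part of the Riemannian volume measure that lies in the chart around `x`: the image of
`√(det gᵢⱼ)` times Lebesgue measure under the inverse chart. -/
def chartVolume [MeasurableSpace E] [BorelSpace E] [MeasurableSpace M]
    (g : BilinField I M) (x : M) : Measure M :=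
  ((b.addHaar.restrict (extChartAt I x).target).withDensity
    (fun y => ENNReal.ofReal (Real.sqrt (Matrix.of (chartMetric b g x y)).det))).map
      (extChartAt I x).symm

/-- The Riemannian volume measure of `g`, the least measure that dominates the volume measures of
all the charts (the latter agree on overlaps, so it restricts to them on the chart domains). -/
def volumeMeasure [MeasurableSpace E] [BorelSpace E] [MeasurableSpace M]
    (g : BilinField I M) : Measure M :=
  ⨆ x : M, chartVolume b g x

/-- The scalar invariant `L₁` of `g` as a function on `M`; it is evaluated at `p` in the chart
around `p`. -/
def L1Density (g : BilinField I M) (p : M) : ℝ :=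
  LocalGeometry.L1 b (chartMetric b g p) (extChartAt I p p)

/-- The total integral `𝓛₁(M, g) = ∫_M L₁ dvol_g`. -/
def L1Functional [MeasurableSpace E] [BorelSpace E] [MeasurableSpace M]
    (g : BilinField I M) : ℝ :=
  ∫ p, L1Density b g p ∂(volumeMeasure b g)

/-- `g` is Einstein: `Ric = Λ g` for a constant `Λ`. -/
def IsEinstein (g : BilinField I M) : Prop :=
  ∃ Λ : ℝ, ∀ (p : M) (i j : ι),
    LocalGeometry.ricci b (chartMetric b g p) (extChartAt I p p) i j
      = Λ * chartMetric b g p (extChartAt I p p) i j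

/-- `g` has constant sectional curvature `K`:
`R(u, v, u, v) = K (g(u, u) g(v, v) - g(u, v)²)` for all tangent vectors `u`, `v`. -/
def HasConstSectionalCurvature (g : BilinField I M) (K : ℝ) : Prop :=
  ∀ (p : M) (u v : ι → ℝ),
    let G := chartMetric b g p
    let y := extChartAt I p p
    let q := fun a c : ι → ℝ => ∑ i, ∑ j, G y i j * a i * c j
    ∑ i, ∑ j, ∑ k, ∑ l, LocalGeometry.riemann b G y i j k l * u i * v j * u k * v l
      = K * (q u u * q v v - q u v ^ 2)

/-- `g` is a critical point of the functional `F` on the space of Riemannian metrics: the first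
variation of `F` at `g` vanishes in the direction of every smooth symmetric `2`-tensor field `k`.
(Where the first variation does not exist, `deriv` is `0`, so to refute criticality one has to
exhibit an existing and nonzero first variation.) -/
def IsCriticalMetric [IsManifold I 1 M] (F : BilinField I M → ℝ) (g : BilinField I M) : Prop :=
  ∀ k : BilinField I M, k.IsSmooth → (∀ p u v, k p u v = k p v u) →
    deriv (fun t : ℝ => F (g + t • k)) 0 = 0

end

/-- The bilinear form `(u, v) ↦ β (A u) (A v)`. -/
def pullBilin {V W : Type*} [NormedAddCommGroup V] [NormedSpace ℝ V] [NormedAddCommGroup W]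
    [NormedSpace ℝ W] (β : W →L[ℝ] W →L[ℝ] ℝ) (A : V →L[ℝ] W) : V →L[ℝ] V →L[ℝ] ℝ :=
  β.bilinearComp A A

section Product

variable {E H : Type*} [NormedAddCommGroup E] [NormedSpace ℝ E] [TopologicalSpace H]
  {I : ModelWithCorners ℝ E H} {M : Type*} [TopologicalSpace M] [ChartedSpace H M]
  {E' H' : Type*} [NormedAddCommGroup E'] [NormedSpace ℝ E'] [TopologicalSpace H']
  {I' : ModelWithCorners ℝ E' H'} {N : Type*} [TopologicalSpace N] [ChartedSpace H' N]

/-- The product metric `g + h = π₁^* g + π₂^* h` on `M × N`, where `π₁`, `π₂` are the two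
projections. -/
def productMetric (g : BilinField I M) (h : BilinField I' N) :
    BilinField (I.prod I') (M × N) := fun p =>
  pullBilin (V := E × E') (W := E) (g p.1) (mfderiv (I.prod I') I Prod.fst p)
    + pullBilin (V := E × E') (W := E') (h p.2) (mfderiv (I.prod I') I' Prod.snd p)

end Product

/-- The unit sphere `Sⁿ` in `ℝⁿ⁺¹`. -/
abbrev Sph (n : ℕ) : Type := Metric.sphere (0 : EuclideanSpace ℝ (Fin (n + 1))) 1

/-- The round metric of the unit sphere `Sⁿ`, induced by the inner product of `ℝⁿ⁺¹`. -/
def roundMetric (n : ℕ) : BilinField (𝓡 n) (Sph n) := fun p =>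
  pullBilin (V := EuclideanSpace ℝ (Fin n)) (W := EuclideanSpace ℝ (Fin (n + 1))) (innerSL ℝ)
    (mfderiv (𝓡 n) 𝓘(ℝ, EuclideanSpace ℝ (Fin (n + 1)))
      (Subtype.val : Sph n → EuclideanSpace ℝ (Fin (n + 1))) p)

/-- The standard basis of `ℝⁿ`. -/
def stdBasis (n : ℕ) : Module.Basis (Fin n) ℝ (EuclideanSpace ℝ (Fin n)) :=
  (EuclideanSpace.basisFun (Fin n) ℝ).toBasis

/-- The standard basis of `ℝ² × ℝ⁴`, the model space of `S² × S⁴`. -/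
def stdBasis24 :
    Module.Basis (Fin 2 ⊕ Fin 4) ℝ (EuclideanSpace ℝ (Fin 2) × EuclideanSpace ℝ (Fin 4)) :=
  (stdBasis 2).prod (stdBasis 4)

/-- The metric of constant sectional curvature `3` on `S²`: a third of the round metric. -/
def metricS2 : BilinField (𝓡 2) (Sph 2) := (1 / 3 : ℝ) • roundMetric 2

/-- The metric of constant sectional curvature `1` on `S⁴`. -/
def metricS4 : BilinField (𝓡 4) (Sph 4) := roundMetric 4

end RiemGeometry

end

/-!
The stereographic charts of Mathlib's spheres are onto the model space, and in them the round
metric is `16 / (4 + |y|²)²` times the Euclidean one (`chartForm_roundMetric`). So in the product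
charts every metric `a g₀ + c h₀` on `S² × S⁴` is a *block metric*: diagonal, with one conformal
factor for each of the two blocks of coordinates.

For block metrics the tensors in `L₁` are computed explicitly, for any number of blocks. The
curvature vanishes unless all indices lie in one block, where it is that of a space form
(`riemannUp_blockMetric`). Hence the Schouten tensor is a combination of the metrics of the blocks,
with constant coefficients, and the Weyl tensor one of products of two of them. Such tensors are
parallel, because the Christoffel symbols preserve the blocks and are compatible with the metric
(`covDeriv4_weighted_blockMetric`). So `∇W` and the Cotton tensor vanish, `|W|²` is constant, and
what remains of `L₁` is an algebraic expression in the eigenvalues of `P` and `W`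
(`L1_blockMetric`). For the curvatures `3` and `1 / c` it equals `36 (3c + 1)² (c - 1) / c³`.

As `L₁` is constant, its integral is this constant times the total volume. The Riemannian measure is
defined as a supremum over charts. By the change of variables formula the measures seen in two
charts agree on the overlap, since the Gram matrices differ by the Jacobian of the transition map;
product charts miss only null sets of each other, so all chart measures are equal
(`chartVolume_eq`), and the volume is an integral over one chart, evaluated in polar coordinates.

Smoothness and positivity of the metrics are read off from their expressions in the charts
(`isRiemannian_of_chartForm`). Finally, the value of `𝓛₁` on `g + c h` has a simple zero at `c = 1`,
so the first variation at `g + h` in the direction `h` is not zero, although `g + h` is Einstein.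
-/

/-! ### Block metrics and their Christoffel symbols -/

namespace LocalGeometry

section PartialDerivatives

variable {E ι : Type*} [NormedAddCommGroup E] [NormedSpace ℝ E]
  (b : Module.Basis ι ℝ E) (i : ι) {f g : E → ℝ} {y : E}

@[simp]
lemma pd_const (c : ℝ) (y : E) : pd b i (fun _ => c) y = 0 := by simp [pd]

lemma pd_mul (hf : DifferentiableAt ℝ f y) (hg : DifferentiableAt ℝ g y) :
    pd b i (fun z => f z * g z) y = f y * pd b i g y + g y * pd b i f y := by
  simp [pd, fderiv_fun_mul hf hg]

lemma pd_const_mul (c : ℝ) (hf : DifferentiableAt ℝ f y) :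
    pd b i (fun z => c * f z) y = c * pd b i f y := by
  simp [pd, fderiv_const_mul hf]

lemma pd_add (hf : DifferentiableAt ℝ f y) (hg : DifferentiableAt ℝ g y) :
    pd b i (fun z => f z + g z) y = pd b i f y + pd b i g y := by
  simp [pd, fderiv_fun_add hf hg]

lemma pd_sub (hf : DifferentiableAt ℝ f y) (hg : DifferentiableAt ℝ g y) :
    pd b i (fun z => f z - g z) y = pd b i f y - pd b i g y := by
  simp [pd, fderiv_fun_sub hf hg]

lemma pd_ite (p : Prop) [Decidable p] :
    pd b i (fun z => if p then f z else 0) y = if p then pd b i f y else 0 := by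
  split_ifs <;> simp

lemma pd_comp {h : ℝ → ℝ} {h' : ℝ} (hh : HasDerivAt h h' (f y)) (hf : DifferentiableAt ℝ f y) :
    pd b i (fun z => h (f z)) y = h' * pd b i f y := by
  have := hh.comp_hasFDerivAt y hf.hasFDerivAt
  simp only [pd]
  rw [show (fun z => h (f z)) = h ∘ f from rfl, this.fderiv]
  simp

end PartialDerivatives

section BlockMetric

variable {E ι κ : Type*} [NormedAddCommGroup E] [NormedSpace ℝ E] [Fintype ι]
  [DecidableEq κ] (b : Module.Basis ι ℝ E) (β : ι → κ) (μ : κ → ℝ)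

/-- The sum of the squares of the coordinates of `y` in the block `a`; the map `β` sends an index to
its block. -/
noncomputable def blockSq (a : κ) (y : E) : ℝ := ∑ i, if β i = a then b.coord i y ^ 2 else 0

/-- The conformal factor of the block `a`: the round metric of a sphere in stereographic
coordinates (based on the hyperplane at distance `2` from the centre of projection), scaled by
`μ a`. -/
noncomputable def blockFactor (a : κ) (y : E) : ℝ := 16 * μ a / (4 + blockSq b β a y) ^ 2

lemma blockSq_nonneg (a : κ) (y : E) : 0 ≤ blockSq b β a y :=
  Finset.sum_nonneg fun i _ => by split_ifs <;> positivity

lemma four_add_blockSq_pos (a : κ) (y : E) : 0 < 4 + blockSq b β a y := by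
  linarith [blockSq_nonneg b β a y]

lemma blockFactor_ne_zero (hμ : ∀ a, μ a ≠ 0) (a : κ) (y : E) : blockFactor b β μ a y ≠ 0 := by
  have := (four_add_blockSq_pos b β a y).ne'
  have := hμ a
  unfold blockFactor
  positivity

lemma contDiff_coord (i : ι) : ContDiff ℝ ∞ (fun y => b.coord i y) := by
  have := b.finiteDimensional_of_finite
  exact (LinearMap.toContinuousLinearMap (b.coord i)).contDiff

lemma contDiff_blockSq (a : κ) : ContDiff ℝ ∞ (blockSq b β a) := by
  refine ContDiff.sum fun i _ => ?_
  split_ifs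
  · exact (contDiff_coord b i).pow 2
  · exact contDiff_const

lemma contDiff_blockFactor (a : κ) : ContDiff ℝ ∞ (blockFactor b β μ a) :=
  contDiff_const.div ((contDiff_const.add (contDiff_blockSq b β a)).pow 2)
    fun y => pow_ne_zero 2 (four_add_blockSq_pos b β a y).ne'

/-- Half of the logarithmic derivative `∂ᵢ` of the conformal factor of the block of `i`. -/
noncomputable def blockLogDeriv (i : ι) (y : E) : ℝ := -2 * b.coord i y / (4 + blockSq b β (β i) y)

lemma contDiff_blockLogDeriv (i : ι) : ContDiff ℝ ∞ (blockLogDeriv b β i) :=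
  (contDiff_const.mul (contDiff_coord b i)).div (contDiff_const.add (contDiff_blockSq b β _))
    fun y => (four_add_blockSq_pos b β _ y).ne'

/-- The block `a` has constant sectional curvature `1 / μ a`. -/
lemma curvature_identity (hμ : ∀ a, μ a ≠ 0) (a : κ) (y : E) :
    2 * (2 / (4 + blockSq b β a y)) - ∑ s, (if β s = a then blockLogDeriv b β s y ^ 2 else 0)
      = (μ a)⁻¹ * blockFactor b β μ a y := by
  have hp := four_add_blockSq_pos b β a y
  have h : ∑ s, (if β s = a then blockLogDeriv b β s y ^ 2 else 0)
      = 4 / (4 + blockSq b β a y) ^ 2 * blockSq b β a y := by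
    rw [blockSq, Finset.mul_sum]
    refine Finset.sum_congr rfl fun s _ => ?_
    split_ifs with hs
    · subst hs
      rw [blockLogDeriv, ← blockSq]
      field_simp
      ring
    · simp
  have := hμ a
  rw [h, blockFactor]
  field_simp
  ring

variable [DecidableEq ι]

/-- The product over all blocks of the round metrics with factors `blockFactor`, in stereographic
coordinates. -/
noncomputable def blockMetric (y : E) (i j : ι) : ℝ :=
  if i = j then blockFactor b β μ (β i) y else 0

lemma contDiff_blockMetric (i j : ι) : ContDiff ℝ ∞ (fun y => blockMetric b β μ y i j) := by
  unfold blockMetric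
  split_ifs
  · exact contDiff_blockFactor b β μ _
  · exact contDiff_const

lemma differentiable_blockMetric (i j : ι) : Differentiable ℝ (fun y => blockMetric b β μ y i j) :=
  (contDiff_blockMetric b β μ i j).differentiable (by simp)

lemma pd_coord (i j : ι) (y : E) : pd b j (fun z => b.coord i z) y = if i = j then 1 else 0 := by
  have := b.finiteDimensional_of_finite
  have h := (LinearMap.toContinuousLinearMap (b.coord i)).hasFDerivAt (x := y)
  have h2 : fderiv ℝ (fun z => b.coord i z) y = LinearMap.toContinuousLinearMap (b.coord i) :=
    h.fderiv
  rw [pd, h2]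
  simp [Finsupp.single_apply, eq_comm]

lemma pd_blockSq (a : κ) (j : ι) (y : E) :
    pd b j (blockSq b β a) y = if β j = a then 2 * b.coord j y else 0 := by
  have hd : ∀ i, DifferentiableAt ℝ (fun y => b.coord i y) y := fun i =>
    (contDiff_coord b i).differentiable (by simp) y
  have hd2 : ∀ i ∈ Finset.univ,
      DifferentiableAt ℝ (fun y => if β i = a then b.coord i y ^ 2 else 0) y := by
    intro i _
    split_ifs
    · exact (hd i).pow 2
    · exact differentiableAt_const _
  have h1 : pd b j (blockSq b β a) y
      = ∑ i, pd b j (fun z => if β i = a then b.coord i z ^ 2 else 0) y := by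
    unfold blockSq
    simp only [pd]
    rw [fderiv_fun_sum hd2]
    simp
  have h2 : ∀ i, pd b j (fun z => b.coord i z ^ 2) y = if i = j then 2 * b.coord i y else 0 := by
    intro i
    simp only [pow_two]
    rw [pd_mul b j (hd i) (hd i), pd_coord]
    split_ifs <;> ring
  rw [h1]
  simp only [pd_ite, h2]
  rw [Finset.sum_eq_single j]
  · simp
  · intro i _ hij
    simp [hij]
  · simp

lemma pd_blockFactor (a : κ) (j : ι) (y : E) :
    pd b j (blockFactor b β μ a) y
      = if β j = a then 2 * blockLogDeriv b β j y * blockFactor b β μ a y else 0 := by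
  have hp := four_add_blockSq_pos b β a y
  have hd : HasDerivAt (fun q : ℝ => 16 * μ a / (4 + q) ^ 2)
      (-(16 * μ a) * 2 / (4 + blockSq b β a y) ^ 3) (blockSq b β a y) := by
    have h1 : HasDerivAt (fun q : ℝ => (4 + q) ^ 2) (2 * (4 + blockSq b β a y))
        (blockSq b β a y) := by
      have := ((hasDerivAt_id (blockSq b β a y)).const_add 4).fun_pow 2
      simpa using this
    have h2 := (hasDerivAt_const (blockSq b β a y) (16 * μ a)).fun_div h1 (by positivity)
    refine h2.congr_deriv ?_
    field_simp
    ring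
  unfold blockFactor
  rw [pd_comp b j hd ((contDiff_blockSq b β a).differentiable (by simp) y), pd_blockSq]
  split_ifs with h
  · subst h
    unfold blockLogDeriv
    field_simp
  · simp

/-- The Hessian of the logarithm of the conformal factor, in the form in which it enters the
curvature of a conformally flat metric. -/
lemma pd_blockLogDeriv (i j : ι) (y : E) :
    pd b j (blockLogDeriv b β i) y
      = (if β j = β i then blockLogDeriv b β i y * blockLogDeriv b β j y else 0)
        - if i = j then 2 / (4 + blockSq b β (β i) y) else 0 := by
  have hp := four_add_blockSq_pos b β (β i) y
  have hd : HasDerivAt (fun q : ℝ => (4 + q)⁻¹)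
      (-1 / (4 + blockSq b β (β i) y) ^ 2) (blockSq b β (β i) y) :=
    ((hasDerivAt_id (blockSq b β (β i) y)).const_add 4).inv hp.ne'
  have hq := (contDiff_blockSq b β (β i)).differentiable (by simp) y
  have h : blockLogDeriv b β i = fun z => (-2 * b.coord i z) * (4 + blockSq b β (β i) z)⁻¹ := by
    funext z; rw [blockLogDeriv, div_eq_mul_inv]
  have hc := (contDiff_coord b i).differentiable (by simp) y
  have hi : DifferentiableAt ℝ (fun z => (4 + blockSq b β (β i) z)⁻¹) y :=
    hd.differentiableAt.comp y hq
  rw [h, pd_mul b j (hc.const_mul _) hi, pd_comp b j hd hq,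
    pd_const_mul b j _ hc, pd_coord, pd_blockSq]
  by_cases h1 : i = j
  · subst h1
    simp only [if_true, blockLogDeriv]
    field_simp
    ring
  · by_cases h2 : β j = β i
    · simp only [h1, h2, if_true, if_false, blockLogDeriv]
      field_simp
      ring
    · simp [h1, h2]

lemma inv_blockMetric (hμ : ∀ a, μ a ≠ 0) (y : E) (i j : ι) :
    inv (blockMetric b β μ) y i j = if i = j then (blockFactor b β μ (β i) y)⁻¹ else 0 := by
  have h : Matrix.of (blockMetric b β μ y)
      = Matrix.diagonal fun i => blockFactor b β μ (β i) y := by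
    ext i j
    simp [blockMetric, Matrix.diagonal_apply]
  have h2 : (Matrix.diagonal fun i => blockFactor b β μ (β i) y)⁻¹
      = Matrix.diagonal fun i => (blockFactor b β μ (β i) y)⁻¹ := by
    refine Matrix.inv_eq_right_inv ?_
    rw [Matrix.diagonal_mul_diagonal, ← Matrix.diagonal_one]
    congr 1
    funext i
    exact mul_inv_cancel₀ (blockFactor_ne_zero b β μ hμ _ y)
  rw [inv, h, h2, Matrix.diagonal_apply]

lemma pd_blockMetric (a i j : ι) (y : E) :
    pd b a (fun z => blockMetric b β μ z i j) y
      = if i = j ∧ β a = β i then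
          2 * blockLogDeriv b β a y * blockFactor b β μ (β i) y else 0 := by
  unfold blockMetric
  rw [pd_ite, pd_blockFactor]
  split_ifs <;> simp_all

lemma christoffel_blockMetric (hμ : ∀ a, μ a ≠ 0) (k i j : ι) (y : E) :
    christoffel b (blockMetric b β μ) k i j y
      = (if j = k ∧ β i = β k then blockLogDeriv b β i y else 0)
        + (if i = k ∧ β j = β k then blockLogDeriv b β j y else 0)
        - (if i = j ∧ β k = β i then blockLogDeriv b β k y else 0) := by
  have hF := blockFactor_ne_zero b β μ hμ (β k) y
  unfold christoffel
  simp only [inv_blockMetric b β μ hμ, ite_mul, zero_mul, Finset.sum_ite_eq, Finset.mem_univ,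
    if_true, pd_blockMetric]
  have e1 : (if j = k ∧ β i = β j then
      2 * blockLogDeriv b β i y * blockFactor b β μ (β j) y else 0)
      = 2 * (if j = k ∧ β i = β k then blockLogDeriv b β i y else 0)
        * blockFactor b β μ (β k) y := by
    by_cases h : j = k
    · subst h; split_ifs <;> simp
    · simp [h]
  have e2 : (if i = k ∧ β j = β i then
      2 * blockLogDeriv b β j y * blockFactor b β μ (β i) y else 0)
      = 2 * (if i = k ∧ β j = β k then blockLogDeriv b β j y else 0)
        * blockFactor b β μ (β k) y := by
    by_cases h : i = k
    · subst h; split_ifs <;> simp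
    · simp [h]
  have e3 : (if i = j ∧ β k = β i then
      2 * blockLogDeriv b β k y * blockFactor b β μ (β i) y else 0)
      = 2 * (if i = j ∧ β k = β i then blockLogDeriv b β k y else 0)
        * blockFactor b β μ (β k) y := by
    split_ifs with h
    · rw [h.2]
    · simp
  rw [e1, e2, e3]
  field_simp

end BlockMetric

/-! ### The curvature of a block metric -/

section BlockCurvature

variable {E ι κ : Type*} [NormedAddCommGroup E] [NormedSpace ℝ E] [Fintype ι]
  [DecidableEq ι] [DecidableEq κ] (b : Module.Basis ι ℝ E) (β : ι → κ) (μ : κ → ℝ)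

lemma pd_christoffel_blockMetric (hμ : ∀ a, μ a ≠ 0) (a k i j : ι) (y : E) :
    pd b a (christoffel b (blockMetric b β μ) k i j) y
      = (if j = k ∧ β i = β k then pd b a (blockLogDeriv b β i) y else 0)
        + (if i = k ∧ β j = β k then pd b a (blockLogDeriv b β j) y else 0)
        - (if i = j ∧ β k = β i then pd b a (blockLogDeriv b β k) y else 0) := by
  have hd : ∀ i, DifferentiableAt ℝ (blockLogDeriv b β i) y := fun i =>
    (contDiff_blockLogDeriv b β i).differentiable (by simp) y
  have hd' : ∀ (p : Prop) [Decidable p] (i : ι),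
      DifferentiableAt ℝ (fun y => if p then blockLogDeriv b β i y else 0) y := by
    intro p _ i
    split_ifs
    · exact hd i
    · exact differentiableAt_const _
  rw [show christoffel b (blockMetric b β μ) k i j = _ from
    funext fun y => christoffel_blockMetric b β μ hμ k i j y]
  rw [pd_sub b a ((hd' _ _).fun_add (hd' _ _)) (hd' _ _), pd_add b a (hd' _ _) (hd' _ _),
    pd_ite, pd_ite, pd_ite]

/-- The quadratic terms `Γ^i_{ks} Γ^s_{lj}` of the curvature. -/
lemma sum_christoffel_mul_christoffel (hμ : ∀ a, μ a ≠ 0) (i j k l : ι) (y : E) :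
    ∑ s, christoffel b (blockMetric b β μ) i k s y * christoffel b (blockMetric b β μ) s l j y
      = (if β k = β i then blockLogDeriv b β k y else 0)
          * christoffel b (blockMetric b β μ) i l j y
        - (if β k = β i then blockLogDeriv b β i y else 0)
          * christoffel b (blockMetric b β μ) k l j y
        + if k = i then
            (if β j = β i ∧ β l = β i then
              2 * (blockLogDeriv b β j y * blockLogDeriv b β l y) else 0)
            - (if l = j ∧ β l = β i then
              ∑ s, (if β s = β i then blockLogDeriv b β s y ^ 2 else 0) else 0)
          else 0 := by
  have h1 : ∀ s, christoffel b (blockMetric b β μ) i k s y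
        * christoffel b (blockMetric b β μ) s l j y
      = (if s = i then (if β k = β i then blockLogDeriv b β k y else 0)
          * christoffel b (blockMetric b β μ) s l j y else 0)
        - (if k = s then (if β k = β i then blockLogDeriv b β i y else 0)
          * christoffel b (blockMetric b β μ) s l j y else 0)
        + (if k = i then
            (if j = s then if β j = β i ∧ β l = β i then
              blockLogDeriv b β j y * blockLogDeriv b β l y else 0 else 0)
            + (if l = s then if β j = β i ∧ β l = β i then
              blockLogDeriv b β j y * blockLogDeriv b β l y else 0 else 0)
            - (if l = j ∧ β l = β i then
              (if β s = β i then blockLogDeriv b β s y ^ 2 else 0) else 0)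
          else 0) := by
    intro s
    simp only [christoffel_blockMetric b β μ hμ i k s]
    by_cases hki : k = i
    · subst hki
      -- `Γ^k_{ks}` is the logarithmic derivative `φ_s` for `s` in the block of `k`.
      have e : (if s = k ∧ β k = β k then blockLogDeriv b β k y else 0)
          + (if k = k ∧ β s = β k then blockLogDeriv b β s y else 0)
          - (if k = s ∧ β k = β k then blockLogDeriv b β k y else 0)
          = if β s = β k then blockLogDeriv b β s y else 0 := by
        simp [eq_comm (a := s)]
      rw [e]
      simp only [christoffel_blockMetric b β μ hμ s l j, if_true, eq_comm (a := k) (b := s)]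
      by_cases hjs : j = s
      · subst hjs
        by_cases hls : l = j
        · subst hls
          split_ifs <;> simp_all <;> ring
        · by_cases h2 : β l = β j <;> by_cases h3 : β j = β k <;> simp_all
      · by_cases hls : l = s
        · subst hls
          by_cases h2 : β l = β j <;> by_cases h3 : β j = β k <;> simp_all [eq_comm, mul_comm]
        · by_cases hlj : l = j
          · subst hlj
            clear e
            by_cases h2 : β s = β l
            · simp only [hjs, false_and, if_false, h2, if_true, true_and]
              split_ifs <;> ring
            · by_cases h3 : β s = β k
              · simp [hjs, h3, show ¬ β l = β k from fun h => h2 (h3.trans h.symm)]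
                intro h
                exact absurd (h3.trans h) h2
              · simp [hjs, h2, h3]
          · simp_all
    · by_cases h2 : β k = β i
      · simp only [hki, h2, and_true, false_and, if_false, if_true]
        split_ifs <;> simp_all
      · simp [hki, h2, Ne.symm h2]
  simp only [h1, Finset.sum_add_distrib, Finset.sum_sub_distrib]
  by_cases hki : k = i
  · subst hki
    simp only [if_true, Finset.sum_add_distrib, Finset.sum_sub_distrib, Finset.sum_ite_eq,
      Finset.sum_ite_eq', Finset.mem_univ]
    by_cases h : l = j ∧ β l = β k
    · simp only [if_pos h]
      split_ifs <;> ring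
    · simp only [h, if_false, Finset.sum_const_zero]
      split_ifs <;> ring
  · simp [hki]

/-- The identity between index expressions behind `riemannUp_blockMetric`. Here `φ` stands for the
logarithmic derivatives of the conformal factors, `N` for the sums of their squares, `h` for the
trace part of their derivatives, `F` for the conformal factors and `m` for the curvatures. If the
indices do not lie in one block, all terms cancel; otherwise one distinguishes which of them
coincide. -/
lemma block_curvature_algebra {ι κ : Type*} [DecidableEq ι] [DecidableEq κ] (β : ι → κ)
    (φ : ι → ℝ) (N h F m : κ → ℝ) (hK : ∀ a, m a * F a = 2 * h a - N a) (i j k l : ι) :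
    (((if j = i ∧ β l = β i then
            (if β k = β l then φ l * φ k else 0) - if l = k then h (β l) else 0 else 0) +
          if l = i ∧ β j = β i then
            (if β k = β j then φ j * φ k else 0) - if j = k then h (β j) else 0 else 0) -
        if l = j ∧ β i = β l then
          (if β k = β i then φ i * φ k else 0) - if i = k then h (β i) else 0 else 0) -
      (((if j = i ∧ β k = β i then
            (if β l = β k then φ k * φ l else 0) - if k = l then h (β k) else 0 else 0) +
          if k = i ∧ β j = β i then
            (if β l = β j then φ j * φ l else 0) - if j = l then h (β j) else 0 else 0) -
        if k = j ∧ β i = β k then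
          (if β l = β i then φ i * φ l else 0) - if i = l then h (β i) else 0 else 0) +
      (((if β k = β i then φ k else 0) *
            (((if j = i ∧ β l = β i then φ l else 0) + if l = i ∧ β j = β i then φ j else 0) -
              if l = j ∧ β i = β l then φ i else 0) -
          (if β k = β i then φ i else 0) *
            (((if j = k ∧ β l = β k then φ l else 0) + if l = k ∧ β j = β k then φ j else 0) -
              if l = j ∧ β k = β l then φ k else 0) +
          if k = i then (if β j = β i ∧ β l = β i then 2 * (φ j * φ l) else 0)
            - if l = j ∧ β l = β i then N (β i) else 0
          else 0) -
        ((if β l = β i then φ l else 0) *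
            (((if j = i ∧ β k = β i then φ k else 0) + if k = i ∧ β j = β i then φ j else 0) -
              if k = j ∧ β i = β k then φ i else 0) -
          (if β l = β i then φ i else 0) *
            (((if j = l ∧ β k = β l then φ k else 0) + if k = l ∧ β j = β l then φ j else 0) -
              if k = j ∧ β l = β k then φ l else 0) +
          if l = i then (if β j = β i ∧ β k = β i then 2 * (φ j * φ k) else 0)
            - if k = j ∧ β k = β i then N (β i) else 0
          else 0)) =
    (if β i = β j then m (β i) else 0) *
      ((if i = k then if j = l then F (β j) else 0 else 0)
        - (if i = l then if j = k then F (β j) else 0 else 0)) := by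
  by_cases hij : β i = β j
  · by_cases hik : β i = β k
    · by_cases hil : β i = β l
      · have hkl : β k = β l := hik.symm.trans hil
        have hjl : β j = β l := hij.symm.trans hil
        simp only [hij, hkl, hjl, if_true, and_true]
        have := hK (β l)
        rcases eq_or_ne k l with rfl | n1
        · simp
        rcases eq_or_ne i k with rfl | n2
        · rcases eq_or_ne i j with rfl | n3
          · simp [n1, n1.symm]; ring
          · rcases eq_or_ne j l with rfl | n4
            · simp [n1, n1.symm]; linear_combination -this
            · simp [n1, n1.symm, n3, n3.symm, n4, n4.symm]; ring
        · rcases eq_or_ne i l with rfl | n3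
          · rcases eq_or_ne i j with rfl | n4
            · simp [n1, n1.symm]; ring
            · rcases eq_or_ne j k with rfl | n5
              · simp [n1, n1.symm]; linear_combination this
              · simp [n1, n1.symm, n4, n4.symm, n5, n5.symm]; ring
          · rcases eq_or_ne i j with rfl | n4
            · simp [n1, n1.symm, n2, n2.symm, n3, n3.symm]
            · rcases eq_or_ne j k with rfl | n5
              · simp [n1, n1.symm, n3, n3.symm, n4, n4.symm]; ring
              · rcases eq_or_ne j l with rfl | n6
                · simp [n1, n1.symm, n2, n2.symm, n4, n4.symm]; ring
                · simp [n1, n1.symm, n2, n2.symm, n3, n3.symm, n4.symm, n5, n5.symm, n6,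
                    n6.symm]
      · have a1 : ¬ β j = β l := fun h => hil (hij.trans h)
        have a2 : ¬ β k = β l := fun h => hil (hik.trans h)
        grind
    · grind
  · by_cases hik : β i = β k
    · have a1 : ¬ β j = β k := fun h => hij (hik.trans h.symm)
      by_cases hil : β i = β l <;> grind
    · by_cases hil : β i = β l
      · have a1 : ¬ β j = β l := fun h => hij (hil.trans h.symm)
        grind
      · by_cases hkl : β k = β l <;> grind

/-- The curvature vanishes unless all indices lie in the same block, where it is the curvature of
a space form. -/
lemma riemannUp_blockMetric (hμ : ∀ a, μ a ≠ 0) (i j k l : ι) (y : E) :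
    riemannUp b (blockMetric b β μ) y i j k l
      = (if β i = β j then (μ (β i))⁻¹ else 0) * ((if i = k then blockMetric b β μ y j l else 0)
        - (if i = l then blockMetric b β μ y j k else 0)) := by
  have hK : ∀ a, (μ a)⁻¹ * blockFactor b β μ a y
      = 2 * (2 / (4 + blockSq b β a y))
        - ∑ s, (if β s = a then blockLogDeriv b β s y ^ 2 else 0) := fun a =>
    (curvature_identity b β μ hμ a y).symm
  unfold riemannUp
  rw [Finset.sum_sub_distrib, sum_christoffel_mul_christoffel b β μ hμ,
    sum_christoffel_mul_christoffel b β μ hμ]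
  simp only [pd_christoffel_blockMetric b β μ hμ, christoffel_blockMetric b β μ hμ,
    pd_blockLogDeriv, blockMetric]
  exact block_curvature_algebra β (fun i => blockLogDeriv b β i y) _ _ _ _ hK i j k l

end BlockCurvature

/-! ### Ricci, Schouten and Weyl tensors, and the invariant `L₁`, of a block metric -/

section DiagonalContraction

variable {ι : Type*} [Fintype ι] [DecidableEq ι] {g : ι → ι → ℝ} {f : ι → ℝ}

lemma inner1_of_diagonal (hg : ∀ i a, g i a = if i = a then f i else 0) (S T : ι → ℝ) :
    inner1 g S T = ∑ i, f i * (S i * T i) := by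
  simp [inner1, hg]

lemma inner2_of_diagonal (hg : ∀ i a, g i a = if i = a then f i else 0) (S T : ι → ι → ℝ) :
    inner2 g S T = ∑ i, f i * ∑ j, f j * (S i j * T i j) := by
  simp [inner2, hg, inner1_of_diagonal hg]

lemma inner3_of_diagonal (hg : ∀ i a, g i a = if i = a then f i else 0) (S T : ι → ι → ι → ℝ) :
    inner3 g S T = ∑ i, f i * ∑ j, f j * ∑ k, f k * (S i j k * T i j k) := by
  simp [inner3, hg, inner2_of_diagonal hg]

lemma inner4_eq_sum_inner3 (hg : ∀ i a, g i a = if i = a then f i else 0)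
    (S T : ι → ι → ι → ι → ℝ) : inner4 g S T = ∑ i, f i * inner3 g (S i) (T i) := by
  simp [inner4, hg]

end DiagonalContraction

section BlockTensors

variable {E ι κ : Type*} [NormedAddCommGroup E] [NormedSpace ℝ E] [Fintype ι]
  [DecidableEq ι] [DecidableEq κ] (b : Module.Basis ι ℝ E) (β : ι → κ) (μ : κ → ℝ)

/-- The Ricci curvature of the block `a`, a space form of sectional curvature `1 / μ a`. -/
noncomputable def blockRicci (a : κ) : ℝ :=
  (μ a)⁻¹ * ((∑ i, if β i = a then (1 : ℝ) else 0) - 1)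

/-- The trace `J` of the Schouten tensor of `blockMetric`. -/
noncomputable def blockJ : ℝ := (∑ i, blockRicci β μ (β i)) / (2 * ((Fintype.card ι : ℝ) - 1))

/-- The eigenvalue of the Schouten tensor of `blockMetric` on the block `a`. -/
noncomputable def blockSchouten (a : κ) : ℝ :=
  (blockRicci β μ a - blockJ β μ) / ((Fintype.card ι : ℝ) - 2)

/-- The sectional value of the Weyl tensor of `blockMetric` on planes spanned by a vector of the
block `a` and a vector of the block `c`. -/
noncomputable def blockWeyl (a c : κ) : ℝ :=
  (if a = c then (μ a)⁻¹ else 0) - blockSchouten β μ a - blockSchouten β μ c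

/-- The sum of the squares of the sectional values of the Weyl tensor on the coordinate planes
that contain the `s`-axis. -/
noncomputable def blockWeylSq (s : ι) : ℝ :=
  ∑ j, if j = s then 0 else blockWeyl β μ (β s) (β j) ^ 2

variable {μ} (hμ : ∀ a, μ a ≠ 0)
include hμ

lemma ricci_blockMetric (i j : ι) (y : E) :
    ricci b (blockMetric b β μ) y i j = blockRicci β μ (β i) * blockMetric b β μ y i j := by
  unfold ricci
  simp only [riemannUp_blockMetric b β μ hμ, if_true, mul_sub, Finset.sum_sub_distrib]
  have e1 : ∑ s, (if β s = β i then (μ (β s))⁻¹ else 0) * blockMetric b β μ y i j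
      = (μ (β i))⁻¹ * (∑ s, if β s = β i then (1 : ℝ) else 0) * blockMetric b β μ y i j := by
    rw [Finset.mul_sum, Finset.sum_mul]
    refine Finset.sum_congr rfl fun s _ => ?_
    split_ifs with h
    · rw [h]; ring
    · simp
  have e2 : ∑ s, (if β s = β i then (μ (β s))⁻¹ else 0)
        * (if s = j then blockMetric b β μ y i s else 0)
      = (μ (β i))⁻¹ * blockMetric b β μ y i j := by
    simp only [mul_ite, mul_zero, Finset.sum_ite_eq', Finset.mem_univ, if_true]
    by_cases h : i = j
    · simp [h]
    · simp [blockMetric, h]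
  rw [e1, e2, blockRicci]
  ring

lemma schoutenTrace_blockMetric (y : E) :
    schoutenTrace b (blockMetric b β μ) y = blockJ β μ := by
  have h := fun i => blockFactor_ne_zero b β μ hμ (β i) y
  simp only [schoutenTrace, blockJ, scalarCurv, inv_blockMetric b β μ hμ, ricci_blockMetric b β hμ,
    blockMetric, ite_mul, zero_mul, Finset.sum_ite_eq, Finset.mem_univ, if_true]
  congr 1
  refine Finset.sum_congr rfl fun i _ => ?_
  have := h i
  field_simp

lemma schouten_blockMetric (i j : ι) (y : E) :
    schouten b (blockMetric b β μ) y i j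
      = blockSchouten β μ (β i) * blockMetric b β μ y i j := by
  rw [schouten, ricci_blockMetric b β hμ, schoutenTrace_blockMetric b β hμ, blockSchouten]
  ring

lemma riemann_blockMetric (i j k l : ι) (y : E) :
    riemann b (blockMetric b β μ) y i j k l
      = (if β i = β j then (μ (β i))⁻¹ else 0)
        * (blockMetric b β μ y i k * blockMetric b β μ y j l
          - blockMetric b β μ y i l * blockMetric b β μ y j k) := by
  simp only [riemann, riemannUp_blockMetric b β μ hμ]
  rw [Finset.sum_eq_single i]
  · simp only [blockMetric, if_true]
    split_ifs <;> ring
  · intro s _ hs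
    simp [blockMetric, hs.symm]
  · simp

lemma weyl_blockMetric (i j k l : ι) (y : E) :
    weyl b (blockMetric b β μ) y i j k l
      = blockWeyl β μ (β i) (β j) * (blockMetric b β μ y i k * blockMetric b β μ y j l
          - blockMetric b β μ y i l * blockMetric b β μ y j k) := by
  rw [weyl, riemann_blockMetric b β hμ]
  simp only [schouten_blockMetric b β hμ, blockWeyl]
  ring

lemma christoffel_blockMetric_of_block_ne {k i j : ι} (h : β k ≠ β j) (y : E) :
    christoffel b (blockMetric b β μ) k i j y = 0 := by
  rw [christoffel_blockMetric b β μ hμ]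
  grind

/-- The Christoffel symbols preserve the blocks, so they commute with weights that depend only on
the block. -/
lemma weight_mul_christoffel (p : κ → ℝ) (k i j : ι) (y : E) :
    christoffel b (blockMetric b β μ) k i j y * p (β k)
      = christoffel b (blockMetric b β μ) k i j y * p (β j) := by
  by_cases h : β k = β j
  · rw [h]
  · simp [christoffel_blockMetric_of_block_ne b β hμ h]

/-- Compatibility of the connection with the metric, checked on the explicit Christoffel symbols. -/
lemma pd_blockMetric_eq_christoffel (a i j : ι) (y : E) :
    pd b a (fun z => blockMetric b β μ z i j) y
      = ∑ s, christoffel b (blockMetric b β μ) s a i y * blockMetric b β μ y s j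
        + ∑ s, christoffel b (blockMetric b β μ) s a j y * blockMetric b β μ y i s := by
  rw [pd_blockMetric]
  simp only [blockMetric, mul_ite, mul_zero, Finset.sum_ite_eq, Finset.sum_ite_eq',
    Finset.mem_univ, if_true]
  simp only [christoffel_blockMetric b β μ hμ]
  grind

lemma covDeriv2_weighted_blockMetric (p : κ → ℝ) (y : E) (a i j : ι) :
    covDeriv2 b (blockMetric b β μ) (fun z i j => p (β i) * blockMetric b β μ z i j) y a i j
      = 0 := by
  unfold covDeriv2
  rw [pd_const_mul b a _ (differentiable_blockMetric b β μ i j y),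
    pd_blockMetric_eq_christoffel b β hμ, ← Finset.sum_add_distrib, Finset.mul_sum,
    ← Finset.sum_sub_distrib]
  refine Finset.sum_eq_zero fun s _ => ?_
  linear_combination (-blockMetric b β μ y s j) * weight_mul_christoffel b β hμ p s a i y

/-- Tensors built from the metrics of the blocks are parallel. -/
lemma covDeriv4_weighted_blockMetric (w : κ → κ → ℝ) (y : E) (a i j k l : ι) :
    covDeriv4 b (blockMetric b β μ) (fun z i j k l => w (β i) (β j)
      * (blockMetric b β μ z i k * blockMetric b β μ z j l
        - blockMetric b β μ z i l * blockMetric b β μ z j k)) y a i j k l = 0 := by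
  have hd := fun i j => differentiable_blockMetric b β μ i j y
  unfold covDeriv4
  rw [pd_const_mul b a _ (((hd i k).fun_mul (hd j l)).fun_sub ((hd i l).fun_mul (hd j k))),
    pd_sub b a ((hd i k).fun_mul (hd j l)) ((hd i l).fun_mul (hd j k)),
    pd_mul b a (hd i k) (hd j l), pd_mul b a (hd i l) (hd j k)]
  simp only [pd_blockMetric_eq_christoffel b β hμ, ← Finset.sum_add_distrib, Finset.mul_sum,
    ← Finset.sum_sub_distrib]
  refine Finset.sum_eq_zero fun s _ => ?_
  have h1 := weight_mul_christoffel b β hμ (fun c => w c (β j)) s a i y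
  have h2 := weight_mul_christoffel b β hμ (fun c => w (β i) c) s a j y
  linear_combination
    (-(blockMetric b β μ y s k * blockMetric b β μ y j l
      - blockMetric b β μ y s l * blockMetric b β μ y j k)) * h1
    - (blockMetric b β μ y i k * blockMetric b β μ y s l
      - blockMetric b β μ y i l * blockMetric b β μ y s k) * h2

lemma cotton_blockMetric (y : E) (i j k : ι) : cotton b (blockMetric b β μ) y i j k = 0 := by
  have h : schouten b (blockMetric b β μ)
      = fun z i j => blockSchouten β μ (β i) * blockMetric b β μ z i j := by
    funext z i j
    exact schouten_blockMetric b β hμ i j z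
  rw [cotton, h]
  simp only [covDeriv2_weighted_blockMetric b β hμ, sub_zero]

lemma covDeriv4_weyl_blockMetric (y : E) (a i j k l : ι) :
    covDeriv4 b (blockMetric b β μ) (weyl b (blockMetric b β μ)) y a i j k l = 0 := by
  have h : weyl b (blockMetric b β μ) = fun z i j k l => blockWeyl β μ (β i) (β j)
      * (blockMetric b β μ z i k * blockMetric b β μ z j l
        - blockMetric b β μ z i l * blockMetric b β μ z j k) := by
    funext z i j k l
    exact weyl_blockMetric b β hμ i j k l z
  rw [h, covDeriv4_weighted_blockMetric b β hμ]

/-- The contraction `W_{sijk} W_t^{ijk}` of a Weyl tensor that is diagonal on bivectors. -/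
lemma inner3_weyl_blockMetric (y : E) (s t : ι) :
    inner3 (inv (blockMetric b β μ) y) (weyl b (blockMetric b β μ) y s)
        (weyl b (blockMetric b β μ) y t)
      = 2 * blockWeylSq β μ s * blockMetric b β μ y s t := by
  have hF := fun i => blockFactor_ne_zero b β μ hμ (β i) y
  rw [inner3_of_diagonal (inv_blockMetric b β μ hμ y)]
  simp only [weyl_blockMetric b β hμ]
  have h1 : ∀ j, ∑ k, (blockFactor b β μ (β k) y)⁻¹ * ∑ l, (blockFactor b β μ (β l) y)⁻¹ *
      (blockWeyl β μ (β s) (β j) * (blockMetric b β μ y s k * blockMetric b β μ y j l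
          - blockMetric b β μ y s l * blockMetric b β μ y j k)
        * (blockWeyl β μ (β t) (β j) * (blockMetric b β μ y t k * blockMetric b β μ y j l
          - blockMetric b β μ y t l * blockMetric b β μ y j k)))
      = if s = t then (if j = s then 0 else
          2 * blockWeyl β μ (β s) (β j) ^ 2 * blockFactor b β μ (β s) y
            * blockFactor b β μ (β j) y) else 0 := by
    intro j
    have hC : ∀ a c, ∑ k, (blockFactor b β μ (β k) y)⁻¹
        * (blockMetric b β μ y a k * blockMetric b β μ y c k) = blockMetric b β μ y a c := by
      intro a c
      have := hF a
      rw [Finset.sum_eq_single a]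
      · by_cases hac : c = a
        · subst hac
          simp only [blockMetric, if_true]
          field_simp
        · simp [blockMetric, hac, Ne.symm hac]
      · intro k _ hk
        simp [blockMetric, hk.symm]
      · simp
    have h2 : ∀ w w' : ℝ, ∑ k, (blockFactor b β μ (β k) y)⁻¹ * ∑ l,
        (blockFactor b β μ (β l) y)⁻¹ *
        (w * (blockMetric b β μ y s k * blockMetric b β μ y j l
          - blockMetric b β μ y s l * blockMetric b β μ y j k)
        * (w' * (blockMetric b β μ y t k * blockMetric b β μ y j l
          - blockMetric b β μ y t l * blockMetric b β μ y j k)))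
        = 2 * w * w' * (blockMetric b β μ y s t * blockMetric b β μ y j j
          - blockMetric b β μ y s j * blockMetric b β μ y t j) := by
      intro w w'
      have e : 2 * w * w' * (blockMetric b β μ y s t * blockMetric b β μ y j j
          - blockMetric b β μ y s j * blockMetric b β μ y t j)
          = w * w' * (blockMetric b β μ y s t * blockMetric b β μ y j j)
            + w * w' * (blockMetric b β μ y j j * blockMetric b β μ y s t)
            - w * w' * (blockMetric b β μ y s j * blockMetric b β μ y t j)
            - w * w' * (blockMetric b β μ y t j * blockMetric b β μ y s j) := by ring
      rw [e, ← hC s t, ← hC j j, ← hC s j, ← hC t j]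
      simp only [Finset.sum_mul_sum]
      simp only [Finset.mul_sum, ← Finset.sum_sub_distrib, ← Finset.sum_add_distrib]
      refine Finset.sum_congr rfl fun k _ => Finset.sum_congr rfl fun l _ => ?_
      ring
    rw [h2]
    simp only [blockMetric]
    by_cases hst : s = t
    · subst hst
      by_cases hjs : j = s
      · subst hjs; simp
      · simp only [if_true, hjs, Ne.symm hjs, if_false]
        ring
    · by_cases hjs : s = j
      · subst hjs
        simp [hst, Ne.symm hst]
      · simp [hst, hjs]
  simp only [h1]
  by_cases hst : s = t
  · subst hst
    simp only [if_true, blockMetric, blockWeylSq, Finset.mul_sum, Finset.sum_mul]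
    refine Finset.sum_congr rfl fun j _ => ?_
    have := hF j
    split_ifs
    · simp
    · field_simp
  · simp [hst, blockMetric]

lemma weylNormSq_blockMetric (y : E) :
    weylNormSq b (blockMetric b β μ) y = 2 * ∑ s, blockWeylSq β μ s := by
  have hF := fun i => blockFactor_ne_zero b β μ hμ (β i) y
  rw [weylNormSq, inner4_eq_sum_inner3 (inv_blockMetric b β μ hμ y), Finset.mul_sum]
  refine Finset.sum_congr rfl fun s _ => ?_
  have := hF s
  rw [inner3_weyl_blockMetric b β hμ, blockMetric, if_pos rfl]
  field_simp

/-- All terms of `L₁` that contain derivatives vanish for a product of space forms. -/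
lemma L1_blockMetric (y : E) :
    L1 b (blockMetric b β μ) y
      = 96 * ∑ s, blockSchouten β μ (β s) * blockWeylSq β μ s
        - 16 * blockJ β μ * ∑ s, blockWeylSq β μ s := by
  have hF := fun i => blockFactor_ne_zero b β μ hμ (β i) y
  have hC : cotton b (blockMetric b β μ) = fun _ _ _ _ => 0 := by
    funext z i j k
    exact cotton_blockMetric b β hμ z i j k
  have hW : covDeriv4 b (blockMetric b β μ) (weyl b (blockMetric b β μ)) y
      = fun _ _ _ _ _ => 0 := by
    funext a i j k l
    exact covDeriv4_weyl_blockMetric b β hμ y a i j k l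
  have hN : weylNormSq b (blockMetric b β μ) = fun _ => 2 * ∑ s, blockWeylSq β μ s := by
    funext z
    exact weylNormSq_blockMetric b β hμ z
  have hP : inner2 (inv (blockMetric b β μ) y) (schouten b (blockMetric b β μ) y)
        (fun s t => inner3 (inv (blockMetric b β μ) y) (weyl b (blockMetric b β μ) y s)
          (weyl b (blockMetric b β μ) y t))
      = 2 * ∑ s, blockSchouten β μ (β s) * blockWeylSq β μ s := by
    rw [inner2_of_diagonal (inv_blockMetric b β μ hμ y), Finset.mul_sum]
    refine Finset.sum_congr rfl fun s _ => ?_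
    rw [Finset.sum_eq_single s]
    · have := hF s
      rw [inner3_weyl_blockMetric b β hμ, schouten_blockMetric b β hμ, blockMetric, if_pos rfl]
      field_simp
    · intro t _ hts
      simp [schouten_blockMetric b β hμ, blockMetric, hts.symm]
    · simp
  rw [L1, hP, hC, hW, hN, schoutenTrace_blockMetric b β hμ]
  simp [laplacian, divergence, covDeriv1, inner3, inner2, inner1, inner5, inner4]
  ring

end BlockTensors

end LocalGeometry

/-! ### Bilinear forms read in a chart -/

namespace RiemGeometry

/-- In Mathlib's notion of a Riemannian metric, positivity comes with boundedness of the unit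
balls. -/
lemma isVonNBounded_of_coercive {E : Type*} [NormedAddCommGroup E] [NormedSpace ℝ E]
    (B : E →L[ℝ] E →L[ℝ] ℝ) {c : ℝ} (hc : 0 < c)
    (h : ∀ u, c * ‖u‖ ^ 2 ≤ B u u) : Bornology.IsVonNBounded ℝ {u | B u u < 1} := by
  refine (NormedSpace.isVonNBounded_ball ℝ E (1 / c + 1)).subset fun u hu => ?_
  have h1 : c * ‖u‖ ^ 2 < 1 := lt_of_le_of_lt (h u) hu
  rw [mem_ball_zero_iff]
  by_contra! hn
  have h0 : 0 < 1 / c := by positivity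
  have h2 : c * (1 / c + 1) ≤ c * ‖u‖ := by gcongr
  have h3 : c * (1 / c + 1) = 1 + c := by field_simp
  nlinarith

section ChartForm

variable {E H : Type*} [NormedAddCommGroup E] [NormedSpace ℝ E] [TopologicalSpace H]
  {I : ModelWithCorners ℝ E H} {M : Type*} [TopologicalSpace M] [ChartedSpace H M]

/-- The field of bilinear forms `g`, read in the chart of `M` around `x` as a form on the model
space; its components are `chartMetric`. -/
noncomputable def chartForm (g : BilinField I M) (x : M) (y : E) : E →L[ℝ] E →L[ℝ] ℝ :=
  pullBilin (V := E) (W := E) (g ((extChartAt I x).symm y))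
    (mfderiv 𝓘(ℝ, E) I (extChartAt I x).symm y)

lemma chartMetric_eq_chartForm {ι : Type*} (b : Module.Basis ι ℝ E) (g : BilinField I M) (x : M)
    (y : E) (i j : ι) : chartMetric b g x y i j = chartForm g x y (b i) (b j) := rfl

lemma chartForm_smul (c : ℝ) (g : BilinField I M) (x : M) (y : E) :
    chartForm (c • g) x y = c • chartForm g x y := rfl

variable [I.Boundaryless] [IsManifold I 1 M]

lemma mdifferentiableAt_extChartAt_symm {x : M} {y : E} (hy : y ∈ (extChartAt I x).target) :
    MDifferentiableAt 𝓘(ℝ, E) I (extChartAt I x).symm y := by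
  have := mdifferentiableWithinAt_extChartAt_symm (I := I) hy
  rwa [I.range_eq_univ, mdifferentiableWithinAt_univ] at this

/-- At the centre of a chart, reading in that chart does nothing: Mathlib's tangent space at `x` is
the model space, identified through the chart at `x`. -/
lemma chartForm_self (g : BilinField I M) (x : M) :
    chartForm g x (extChartAt I x x) = (g x : E →L[ℝ] E →L[ℝ] ℝ) := by
  have h := mfderivWithin_extChartAt_symm_comp_mfderiv_extChartAt
    (I := I) (x := x) (y := extChartAt I x x) (by simp)
  rw [I.range_eq_univ, mfderivWithin_univ] at h
  let G : M → E →L[ℝ] E →L[ℝ] ℝ := g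
  let A : E →L[ℝ] E := mfderiv 𝓘(ℝ, E) I (extChartAt I x).symm (extChartAt I x x)
  let D : M → E →L[ℝ] E := fun z => mfderiv I 𝓘(ℝ, E) (extChartAt I x) z
  have hA : A = ContinuousLinearMap.id ℝ E := by
    have h1 : A.comp (D ((extChartAt I x).symm (extChartAt I x x)))
        = ContinuousLinearMap.id ℝ E := h
    have h2 : D x = ContinuousLinearMap.id ℝ E := mfderiv_extChartAt_self
    rwa [extChartAt_to_inv, h2, ContinuousLinearMap.comp_id] at h1
  ext u v
  change G ((extChartAt I x).symm (extChartAt I x x)) (A u) (A v) = G x u v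
  rw [extChartAt_to_inv, hA]
  rfl

/-- The transformation law of a covariant tensor under a change of charts. -/
lemma chartForm_transition (g : BilinField I M) {x x' : M} {y : E}
    (hy : y ∈ (extChartAt I x).target)
    (hy' : (extChartAt I x).symm y ∈ (extChartAt I x').source) (u v : E) :
    chartForm g x y u v = chartForm g x' (extChartAt I x' ((extChartAt I x).symm y))
      (fderiv ℝ (extChartAt I x' ∘ (extChartAt I x).symm) y u)
      (fderiv ℝ (extChartAt I x' ∘ (extChartAt I x).symm) y v) := by
  have hσ := mdifferentiableAt_extChartAt_symm hy
  have hφ : MDifferentiableAt I 𝓘(ℝ, E) (extChartAt I x') ((extChartAt I x).symm y) :=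
    mdifferentiableAt_extChartAt (by simpa using hy')
  have hσ' := mdifferentiableAt_extChartAt_symm ((extChartAt I x').map_source hy')
  have hev : (extChartAt I x).symm =ᶠ[nhds y]
      (extChartAt I x').symm ∘ (extChartAt I x' ∘ (extChartAt I x).symm) := by
    filter_upwards [hσ.continuousAt.preimage_mem_nhds
      ((isOpen_extChartAt_source x').mem_nhds hy')] with z hz
    exact ((extChartAt I x').left_inv hz).symm
  have h1 : mfderiv 𝓘(ℝ, E) I (extChartAt I x).symm y = _ := hev.mfderiv_eq
  rw [mfderiv_comp y (I' := 𝓘(ℝ, E)) hσ' (hφ.comp y hσ), mfderiv_eq_fderiv] at h1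
  have h2 : (extChartAt I x').symm (extChartAt I x' ((extChartAt I x).symm y))
      = (extChartAt I x).symm y := (extChartAt I x').left_inv hy'
  let G : M → E →L[ℝ] E →L[ℝ] ℝ := g
  let A : E →L[ℝ] E := mfderiv 𝓘(ℝ, E) I (extChartAt I x).symm y
  let A' : E →L[ℝ] E := mfderiv 𝓘(ℝ, E) I (extChartAt I x').symm
    (extChartAt I x' ((extChartAt I x).symm y))
  have h3 : A = A'.comp (fderiv ℝ (extChartAt I x' ∘ (extChartAt I x).symm) y) := h1
  change G ((extChartAt I x).symm y) (A u) (A v)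
    = G ((extChartAt I x').symm (extChartAt I x' ((extChartAt I x).symm y))) (A' _) (A' _)
  rw [h2, h3]
  rfl

/-- Smoothness of a field of bilinear forms can be checked on its components in the charts. -/
lemma isSmooth_of_chartForm [IsManifold I ∞ M] {g : BilinField I M}
    (hg : ∀ x, ∃ Φ : E → E →L[ℝ] E →L[ℝ] ℝ, ContDiff ℝ ∞ Φ ∧
      ∀ y ∈ (extChartAt I x).target, chartForm g x y = Φ y) : g.IsSmooth := by
  intro x₀
  obtain ⟨Φ, hΦ, hgΦ⟩ := hg x₀
  rw [contMDiffAt_hom_bundle]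
  refine ⟨contMDiffAt_id, ?_⟩
  have h1 : ContMDiffAt I 𝓘(ℝ, E →L[ℝ] E →L[ℝ] ℝ) ∞ (Φ ∘ extChartAt I x₀) x₀ :=
    hΦ.contMDiff.contMDiffAt.comp x₀ contMDiffAt_extChartAt
  refine h1.congr_of_eventuallyEq ?_
  filter_upwards [(chartAt H x₀).open_source.mem_nhds (mem_chart_source H x₀)] with x hx
  ext u v
  have hx' : x ∈ (extChartAt I x₀).source := by simpa using hx
  have hs := TangentBundle.symmL_trivializationAt (I := I) hx
  rw [I.range_eq_univ, mfderivWithin_univ] at hs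
  rw [inCoordinates_apply_eq₂ (by simpa using hx) (by simpa using hx) (Set.mem_univ _)]
  let G : M → E →L[ℝ] E →L[ℝ] ℝ := g
  let A : E →L[ℝ] E := mfderiv 𝓘(ℝ, E) I (extChartAt I x₀).symm (extChartAt I x₀ x)
  have hs' : ∀ w : E, (trivializationAt E (TangentSpace I) x₀).symm x w = A w := fun w => by
    have h2 := DFunLike.congr_fun hs w
    exact (Trivialization.symmL_apply (R := ℝ) _ (by simpa using hx) w).symm.trans h2
  rw [Function.comp_apply, ← hgΦ _ ((extChartAt I x₀).map_source hx'), hs', hs']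
  change _ = G ((extChartAt I x₀).symm (extChartAt I x₀ x)) (A u) (A v)
  rw [(extChartAt I x₀).left_inv hx']
  simp
  rfl

/-- A field of bilinear forms that is smooth, symmetric and positive definite in every chart is a
Riemannian metric. -/
lemma isRiemannian_of_chartForm [IsManifold I ∞ M] {g : BilinField I M}
    (hg : ∀ x, ∃ Φ : E → E →L[ℝ] E →L[ℝ] ℝ, ContDiff ℝ ∞ Φ ∧
      ∀ y ∈ (extChartAt I x).target, chartForm g x y = Φ y)
    (hsymm : ∀ x u v, chartForm g x (extChartAt I x x) u v
      = chartForm g x (extChartAt I x x) v u)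
    (hpos : ∀ x, ∃ c > 0, ∀ u, c * ‖u‖ ^ 2 ≤ chartForm g x (extChartAt I x x) u u) :
    g.IsRiemannian := by
  refine ⟨⟨g, fun x u v => ?_, fun x u hu => ?_, fun x => ?_, isSmooth_of_chartForm hg⟩, rfl⟩
  · have := hsymm x u v
    rwa [chartForm_self] at this
  · obtain ⟨c, hc, h⟩ := hpos x
    have h1 := h u
    rw [chartForm_self] at h1
    have h2 : 0 < norm (E := E) u := norm_pos_iff.mpr hu
    exact lt_of_lt_of_le (by positivity) h1
  · obtain ⟨c, hc, h⟩ := hpos x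
    simp only [chartForm_self] at h
    exact isVonNBounded_of_coercive (E := E) (g x) hc h

end ChartForm

/-! ### The volume measure in a chart -/

section ChartVolume

variable {E H : Type*} [NormedAddCommGroup E] [NormedSpace ℝ E] [TopologicalSpace H]
  {I : ModelWithCorners ℝ E H} {M : Type*} [TopologicalSpace M] [ChartedSpace H M]

lemma continuous_extChartAt_symm_of_target_eq_univ {x : M}
    (hT : (extChartAt I x).target = Set.univ) : Continuous (extChartAt I x).symm := by
  have := continuousOn_extChartAt_symm (I := I) x
  rwa [hT, continuousOn_univ] at this

variable {ι : Type*} [Fintype ι] [DecidableEq ι] (b : Module.Basis ι ℝ E) (g : BilinField I M)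

lemma chartVolume_apply [MeasurableSpace E] [BorelSpace E] [MeasurableSpace M] [BorelSpace M]
    {x : M} (hT : (extChartAt I x).target = Set.univ) {s : Set M}
    (hs : MeasurableSet s) :
    chartVolume b g x s = ∫⁻ y in (extChartAt I x).symm ⁻¹' s,
      ENNReal.ofReal (Real.sqrt (Matrix.of (chartMetric b g x y)).det) ∂b.addHaar := by
  have hc := (continuous_extChartAt_symm_of_target_eq_univ hT).measurable
  rw [chartVolume, Measure.map_apply hc hs, withDensity_apply _ (hc hs), hT,
    Measure.restrict_univ]

variable [I.Boundaryless] [IsManifold I 1 M]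

/-- The Gram determinants of a metric in two charts differ by the square of the Jacobian of the
change of charts. -/
lemma det_chartMetric_transition {x x' : M} {y : E}
    (hy : y ∈ (extChartAt I x).target)
    (hy' : (extChartAt I x).symm y ∈ (extChartAt I x').source) :
    (Matrix.of (chartMetric b g x y)).det
      = (fderiv ℝ (extChartAt I x' ∘ (extChartAt I x).symm) y).det ^ 2
        * (Matrix.of (chartMetric b g x' (extChartAt I x' ((extChartAt I x).symm y)))).det := by
  set D := fderiv ℝ (extChartAt I x' ∘ (extChartAt I x).symm) y
  let A : Matrix ι ι ℝ := LinearMap.toMatrix b b (D : E →ₗ[ℝ] E)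
  have hA : ∀ j, D (b j) = ∑ k, A k j • b k := by
    intro j
    have := b.sum_repr (D (b j))
    simp only [A, LinearMap.toMatrix_apply]
    exact this.symm
  have h1 : Matrix.of (chartMetric b g x y)
      = A.transpose *
          Matrix.of (chartMetric b g x' (extChartAt I x' ((extChartAt I x).symm y))) * A := by
    ext i j
    rw [Matrix.of_apply, chartMetric_eq_chartForm, chartForm_transition g hy hy', hA, hA]
    simp only [Matrix.mul_apply, Matrix.transpose_apply, Matrix.of_apply, map_sum, map_smul,
      sum_apply, smul_apply, smul_eq_mul,
      Finset.sum_mul, chartMetric_eq_chartForm, Finset.mul_sum]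
    refine Finset.sum_congr rfl fun k _ => Finset.sum_congr rfl fun l _ => ?_
    ring
  have h2 : A.det = D.det := by
    rw [LinearMap.det_toMatrix]
  rw [h1, Matrix.det_mul, Matrix.det_mul, Matrix.det_transpose, h2]
  ring

variable [MeasurableSpace E] [BorelSpace E] [MeasurableSpace M] [BorelSpace M]

/-- The part of the volume measure seen in a chart does not depend on the chart, if all charts are
onto the model space and miss only null sets of each other. -/
lemma chartVolume_eq (hT : ∀ x : M, (extChartAt I x).target = Set.univ)
    (hN : ∀ x x' : M, b.addHaar ((extChartAt I x).symm ⁻¹' (extChartAt I x').sourceᶜ) = 0)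
    (x x' : M) : chartVolume b g x = chartVolume b g x' := by
  have := b.finiteDimensional_of_finite
  ext s hs
  rw [chartVolume_apply b g (hT x) hs, chartVolume_apply b g (hT x') hs]
  have hm : ∀ x : M, Measurable (extChartAt I x).symm := fun x =>
    (continuous_extChartAt_symm_of_target_eq_univ (hT x)).measurable
  set σ := (extChartAt I x).symm with hσ
  set σ' := (extChartAt I x').symm with hσ'
  set τ : E → E := extChartAt I x' ∘ σ with hτ
  have hmem : ∀ (x : M) (y : E), y ∈ (extChartAt I x).target := fun x y => by
    rw [hT x]; exact Set.mem_univ y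
  -- The points of either chart that lie in the other one fill it up to a null set.
  have hnull : ∀ x x' : M, ((extChartAt I x).symm ⁻¹' (s ∩ (extChartAt I x').source) : Set E)
      =ᵐ[b.addHaar] ((extChartAt I x).symm ⁻¹' s : Set E) := by
    intro x x'
    rw [Set.preimage_inter]
    refine inter_ae_eq_left_of_ae_eq_univ ?_
    rw [ae_eq_univ]
    exact hN x x'
  have himage : τ '' (σ ⁻¹' (s ∩ (extChartAt I x').source))
      = σ' ⁻¹' (s ∩ (extChartAt I x).source) := by
    ext z
    constructor
    · rintro ⟨y, ⟨hy1, hy2⟩, rfl⟩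
      have h1 : σ' (τ y) = σ y := (extChartAt I x').left_inv hy2
      rw [Set.mem_preimage, h1]
      exact ⟨hy1, (extChartAt I x).map_target (hmem x y)⟩
    · rintro ⟨hz1, hz2⟩
      refine ⟨extChartAt I x (σ' z), ?_, ?_⟩
      · have h1 : σ (extChartAt I x (σ' z)) = σ' z := (extChartAt I x).left_inv hz2
        rw [Set.mem_preimage, h1]
        exact ⟨hz1, (extChartAt I x').map_target (hmem x' z)⟩
      · have h1 : σ (extChartAt I x (σ' z)) = σ' z := (extChartAt I x).left_inv hz2
        rw [hτ, Function.comp_apply, h1]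
        exact (extChartAt I x').right_inv (hmem x' z)
  have hinj : Set.InjOn τ (σ ⁻¹' (s ∩ (extChartAt I x').source)) := by
    rintro y ⟨_, hy⟩ z ⟨_, hz⟩ hyz
    have h1 : σ y = σ z := (extChartAt I x').injOn hy hz hyz
    exact (extChartAt I x).symm.injOn (hmem x y) (hmem x z) h1
  have hd : ∀ y ∈ σ ⁻¹' (s ∩ (extChartAt I x').source),
      HasFDerivWithinAt τ (fderiv ℝ τ y) (σ ⁻¹' (s ∩ (extChartAt I x').source)) y := by
    rintro y ⟨_, hy⟩
    have h1 : MDifferentiableAt 𝓘(ℝ, E) 𝓘(ℝ, E) τ y :=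
      (mdifferentiableAt_extChartAt (by simpa using hy)).comp y
        (mdifferentiableAt_extChartAt_symm (hmem x y))
    exact h1.differentiableAt.hasFDerivAt.hasFDerivWithinAt
  rw [← setLIntegral_congr (hnull x x'), ← setLIntegral_congr (hnull x' x), ← himage,
    lintegral_image_eq_lintegral_abs_det_fderiv_mul _
      (hm x (hs.inter (isOpen_extChartAt_source x').measurableSet)) hd hinj]
  refine setLIntegral_congr_fun (hm x (hs.inter (isOpen_extChartAt_source x').measurableSet))
    fun y hy => ?_
  rw [← ENNReal.ofReal_mul (abs_nonneg _), det_chartMetric_transition b g (hmem x y) hy.2,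
    Real.sqrt_mul (sq_nonneg _), Real.sqrt_sq_eq_abs]
  rfl

lemma volumeMeasure_eq_chartVolume (hT : ∀ x : M, (extChartAt I x).target = Set.univ)
    (hN : ∀ x x' : M, b.addHaar ((extChartAt I x).symm ⁻¹' (extChartAt I x').sourceᶜ) = 0)
    (x : M) : volumeMeasure b g = chartVolume b g x := by
  have : Nonempty M := ⟨x⟩
  rw [volumeMeasure, show (fun x' => chartVolume b g x') = fun _ => chartVolume b g x from
    funext fun x' => chartVolume_eq b g hT hN x' x, iSup_const]

end ChartVolume

/-! ### The round metric in stereographic coordinates -/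

section Stereographic

variable {V W : Type*} [NormedAddCommGroup V] [InnerProductSpace ℝ V] [NormedAddCommGroup W]
  [InnerProductSpace ℝ W]

/-- Inverse stereographic projection from the unit vector `v`, in coordinates given by a linear
isometry `U` onto the orthogonal complement of `v`. -/
noncomputable def stereoInv (U : V →ₗᵢ[ℝ] W) (v : W) (y : V) : W :=
  (‖y‖ ^ 2 + 4)⁻¹ • ((4 : ℝ) • U y + (‖y‖ ^ 2 - 4) • v)

lemma hasFDerivAt_stereoInv (U : V →ₗᵢ[ℝ] W) (v : W) (y : V) :
    ∃ D : V →L[ℝ] W, HasFDerivAt (stereoInv U v) D y ∧ ∀ a, D a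
      = (4 * (‖y‖ ^ 2 + 4)⁻¹) • U a + (-8 * inner ℝ y a * ((‖y‖ ^ 2 + 4)⁻¹) ^ 2) • U y
        + (16 * inner ℝ y a * ((‖y‖ ^ 2 + 4)⁻¹) ^ 2) • v := by
  have hpos : (0 : ℝ) < ‖y‖ ^ 2 + 4 := by positivity
  have hN : HasFDerivAt (fun y : V => ‖y‖ ^ 2) (2 • (innerSL ℝ y)) y :=
    (hasStrictFDerivAt_norm_sq y).hasFDerivAt
  have hc : HasFDerivAt (fun y : V => (‖y‖ ^ 2 + 4)⁻¹)
      ((-((‖y‖ ^ 2 + 4) ^ 2)⁻¹) • (2 • (innerSL ℝ y))) y :=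
    (hasDerivAt_inv hpos.ne').comp_hasFDerivAt y (hN.add_const 4)
  have hU : HasFDerivAt (fun y : V => (4 : ℝ) • U y)
      ((4 : ℝ) • U.toContinuousLinearMap) y :=
    U.toContinuousLinearMap.hasFDerivAt.const_smul (4 : ℝ)
  have hv : HasFDerivAt (fun y : V => (‖y‖ ^ 2 - 4) • v)
      ((2 • (innerSL ℝ y)).smulRight v) y :=
    (hN.sub_const 4).smul_const v
  refine ⟨_, hc.smul (hU.add hv), fun a => ?_⟩
  simp
  match_scalars <;> field_simp <;> ring

/-- Inverse stereographic projection is conformal. -/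
lemma inner_fderiv_stereoInv {U : V →ₗᵢ[ℝ] W} {v : W} (hv : ‖v‖ = 1)
    (hU : ∀ y, inner ℝ (U y) v = 0) (y a c : V) :
    inner ℝ (fderiv ℝ (stereoInv U v) y a) (fderiv ℝ (stereoInv U v) y c)
      = 16 / (4 + ‖y‖ ^ 2) ^ 2 * inner ℝ a c := by
  obtain ⟨D, hD, h⟩ := hasFDerivAt_stereoInv U v y
  have hpos : (0 : ℝ) < 4 + ‖y‖ ^ 2 := by positivity
  have hU' : ∀ y, inner ℝ v (U y) = 0 := fun y => by rw [real_inner_comm, hU]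
  rw [hD.fderiv, h, h]
  simp only [inner_add_left, inner_add_right, inner_smul_left, inner_smul_right, hU, hU',
    U.inner_map_map, real_inner_self_eq_norm_sq, hv, conj_trivial, real_inner_comm y a]
  field_simp
  ring

end Stereographic

section Sphere

variable {n : ℕ}

lemma extChartAt_sphere_target (x : Sph n) : (extChartAt (𝓡 n) x).target = Set.univ := by
  have := Fact.mk (@finrank_euclideanSpace_fin ℝ _ (n + 1))
  have h : (chartAt (EuclideanSpace ℝ (Fin n)) x).target = Set.univ :=
    stereographic'_target (-x)
  simp [h]

lemma extChartAt_sphere_source (x : Sph n) : (extChartAt (𝓡 n) x).source = {-x}ᶜ := by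
  have := Fact.mk (@finrank_euclideanSpace_fin ℝ _ (n + 1))
  rw [extChartAt_source]
  exact stereographic'_source (-x)

lemma extChartAt_sphere_symm (x : Sph n) :
    ∃ (U : EuclideanSpace ℝ (Fin n) →ₗᵢ[ℝ] EuclideanSpace ℝ (Fin (n + 1)))
      (v : EuclideanSpace ℝ (Fin (n + 1))), ‖v‖ = 1 ∧ (∀ y, inner ℝ (U y) v = 0) ∧
      ∀ y, ((extChartAt (𝓡 n) x).symm y : EuclideanSpace ℝ (Fin (n + 1))) = stereoInv U v y := by
  have := Fact.mk (@finrank_euclideanSpace_fin ℝ _ (n + 1))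
  let B := (OrthonormalBasis.fromOrthogonalSpanSingleton (𝕜 := ℝ) n
    (ne_zero_of_mem_unit_sphere (-x))).repr
  refine ⟨(Submodule.subtypeₗᵢ _).comp B.symm.toLinearIsometry, (-x : Sph n), ?_, ?_, ?_⟩
  · exact norm_eq_of_mem_sphere _
  · intro y
    have h := (B.symm y).2
    rw [Submodule.mem_orthogonal_singleton_iff_inner_left] at h
    exact h
  · intro y
    have h := stereographic'_symm_apply (n := n) (-x) y
    refine Eq.trans ?_ (h.trans ?_)
    · rfl
    · simp only [stereoInv, smul_add, ← Submodule.coe_norm, LinearIsometryEquiv.norm_map]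
      rfl

lemma chartForm_roundMetric (x : Sph n) (y : EuclideanSpace ℝ (Fin n)) :
    chartForm (roundMetric n) x y = (16 / (4 + ‖y‖ ^ 2) ^ 2) •
      (innerSL ℝ : EuclideanSpace ℝ (Fin n) →L[ℝ] EuclideanSpace ℝ (Fin n) →L[ℝ] ℝ) := by
  have := Fact.mk (@finrank_euclideanSpace_fin ℝ _ (n + 1))
  obtain ⟨U, v, hv, hU, h⟩ := extChartAt_sphere_symm x
  have hσ : MDifferentiableAt 𝓘(ℝ, EuclideanSpace ℝ (Fin n)) (𝓡 n)
      (extChartAt (𝓡 n) x).symm y :=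
    mdifferentiableAt_extChartAt_symm (by rw [extChartAt_sphere_target]; trivial)
  have hval : MDifferentiableAt (𝓡 n) 𝓘(ℝ, EuclideanSpace ℝ (Fin (n + 1)))
      (Subtype.val : Sph n → EuclideanSpace ℝ (Fin (n + 1))) ((extChartAt (𝓡 n) x).symm y) :=
    (contMDiff_coe_sphere (m := 1)).mdifferentiable (by simp) _
  have h1 := mfderiv_comp y hval hσ
  have h2 : (Subtype.val : Sph n → EuclideanSpace ℝ (Fin (n + 1))) ∘ (extChartAt (𝓡 n) x).symm
      = stereoInv U v := funext h
  rw [h2, mfderiv_eq_fderiv] at h1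
  ext a c
  have h3 := inner_fderiv_stereoInv hv hU y a c
  rw [h1] at h3
  exact h3

end Sphere

/-! ### Radial integrals and scaled round metrics -/

section RadialIntegrals

/-- Integration of a radial function in polar coordinates, by means of an antiderivative `g` of
`r ↦ r ^ (d - 1) * f r`. -/
lemma lintegral_radial {d : ℕ} (hd : d ≠ 0) {f g : ℝ → ℝ} {l v : ℝ} (hf : ∀ r, 0 ≤ f r)
    (hg : ∀ r, HasDerivAt g (r ^ (d - 1) * f r) r) (hl : Filter.Tendsto g Filter.atTop (nhds l))
    (hv : (volume : Measure (EuclideanSpace ℝ (Fin d))).real (Metric.ball 0 1) = v) :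
    ∫⁻ y : EuclideanSpace ℝ (Fin d), ENNReal.ofReal (f ‖y‖) =
      ENNReal.ofReal (d * v * (l - g 0)) := by
  have : Nontrivial (EuclideanSpace ℝ (Fin d)) := by
    refine Module.nontrivial_of_finrank_pos (R := ℝ) ?_
    simpa using Nat.pos_of_ne_zero hd
  have hpos : ∀ r ∈ Set.Ioi (0 : ℝ), 0 ≤ r ^ (d - 1) * f r := fun r hr =>
    mul_nonneg (pow_nonneg (le_of_lt hr) _) (hf r)
  have hint : Integrable (fun y : EuclideanSpace ℝ (Fin d) => f ‖y‖) := by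
    rw [integrable_fun_norm_addHaar]
    simpa using integrableOn_Ioi_deriv_of_nonneg' (fun r _ => hg r) hpos hl
  have hval := integral_fun_norm_addHaar (volume : Measure (EuclideanSpace ℝ (Fin d))) f
  simp only [finrank_euclideanSpace_fin, smul_eq_mul, nsmul_eq_mul, hv,
    integral_Ioi_of_hasDerivAt_of_nonneg' (fun r _ => hg r) hpos hl] at hval
  rw [← ofReal_integral_eq_lintegral_ofReal hint (Filter.Eventually.of_forall fun y => hf _), hval,
    mul_assoc]

lemma tendsto_inv_four_add_sq :
    Filter.Tendsto (fun r : ℝ => (4 + r ^ 2)⁻¹) Filter.atTop (nhds 0) :=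
  tendsto_inv_atTop_zero.comp
    (Filter.tendsto_atTop_add_const_left _ _ (Filter.tendsto_pow_atTop two_ne_zero))

lemma hasDerivAt_inv_four_add_sq (r : ℝ) :
    HasDerivAt (fun r : ℝ => (4 + r ^ 2)⁻¹) (-(2 * r) / (4 + r ^ 2) ^ 2) r := by
  have h := ((hasDerivAt_pow 2 r).const_add 4).fun_inv (by positivity)
  simpa using h

lemma lintegral_stereographic_two (c : ℝ) (hc : 0 ≤ c) :
    ∫⁻ y : EuclideanSpace ℝ (Fin 2), ENNReal.ofReal (16 * c / (4 + ‖y‖ ^ 2) ^ 2)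
      = ENNReal.ofReal (4 * Real.pi * c) := by
  have hv : (volume : Measure (EuclideanSpace ℝ (Fin 2))).real (Metric.ball 0 1) = Real.pi := by
    rw [Measure.real, InnerProductSpace.volume_ball_of_dim_even (k := 1) (by simp)]
    simp [Real.pi_nonneg]
  have h := lintegral_radial (d := 2) (by simp) (f := fun r => 16 * c / (4 + r ^ 2) ^ 2)
    (g := fun r => -(8 * c) * (4 + r ^ 2)⁻¹) (l := -(8 * c) * 0) (fun r => by positivity)
    (fun r => ((hasDerivAt_inv_four_add_sq r).const_mul _).congr_deriv (by simp; ring))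
    (tendsto_inv_four_add_sq.const_mul _) hv
  rw [h]
  congr 1
  norm_num
  ring

lemma lintegral_stereographic_four (c : ℝ) :
    ∫⁻ y : EuclideanSpace ℝ (Fin 4), ENNReal.ofReal ((16 * c / (4 + ‖y‖ ^ 2) ^ 2) ^ 2)
      = ENNReal.ofReal (8 / 3 * Real.pi ^ 2 * c ^ 2) := by
  have hv : (volume : Measure (EuclideanSpace ℝ (Fin 4))).real (Metric.ball 0 1)
      = Real.pi ^ 2 / 2 := by
    rw [Measure.real, InnerProductSpace.volume_ball_of_dim_even (k := 2) (by simp)]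
    simp [Nat.factorial, div_nonneg (sq_nonneg Real.pi)]
  have h := lintegral_radial (d := 4) (by simp) (f := fun r => (16 * c / (4 + r ^ 2) ^ 2) ^ 2)
    (g := fun r => 256 * c ^ 2 * (-(1 / 4) * ((4 + r ^ 2)⁻¹) ^ 2 + 2 / 3 * ((4 + r ^ 2)⁻¹) ^ 3))
    (l := 256 * c ^ 2 * (-(1 / 4) * 0 ^ 2 + 2 / 3 * 0 ^ 3)) (fun r => by positivity)
    (fun r => by
      have h1 := hasDerivAt_inv_four_add_sq r
      refine (((h1.fun_pow 2).const_mul (-(1 / 4))).fun_add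
        ((h1.fun_pow 3).const_mul (2 / 3)) |>.const_mul _).congr_deriv ?_
      have : (4 + r ^ 2) ≠ 0 := by positivity
      simp only [Nat.cast_ofNat, Nat.add_one_sub_one]
      field_simp
      ring)
    ((((tendsto_inv_four_add_sq.pow 2).const_mul _).add
      ((tendsto_inv_four_add_sq.pow 3).const_mul _)).const_mul _) hv
  rw [h]
  congr 1
  norm_num
  ring

end RadialIntegrals

section SpaceForms

open LocalGeometry

lemma stdBasis_coord (n : ℕ) (i : Fin n) (y : EuclideanSpace ℝ (Fin n)) :
    (stdBasis n).coord i y = y i := by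
  simp [stdBasis]

lemma chartForm_smul_roundMetric_apply {n : ℕ} (c : ℝ) (x : Sph n)
    (y u v : EuclideanSpace ℝ (Fin n)) :
    chartForm (c • roundMetric n) x y u v = 16 * c / (4 + ‖y‖ ^ 2) ^ 2 * inner ℝ u v := by
  rw [chartForm_smul, chartForm_roundMetric]
  change c * (16 / (4 + ‖y‖ ^ 2) ^ 2 * inner ℝ u v) = _
  ring

lemma contDiff_conformalFactor_smul {V F : Type*} [NormedAddCommGroup V] [InnerProductSpace ℝ V]
    [NormedAddCommGroup F] [NormedSpace ℝ F] (c : ℝ) (L : F) :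
    ContDiff ℝ ∞ (fun y : V => c • ((16 / (4 + ‖y‖ ^ 2) ^ 2) • L)) :=
  ContDiff.const_smul c (ContDiff.smul (contDiff_const.div
    ((contDiff_const.add (contDiff_norm_sq ℝ)).pow 2) fun y => by positivity) contDiff_const)

lemma exists_contDiff_chartForm_smul_roundMetric {n : ℕ} (c : ℝ) (x : Sph n) :
    ∃ Φ : EuclideanSpace ℝ (Fin n) →
        EuclideanSpace ℝ (Fin n) →L[ℝ] EuclideanSpace ℝ (Fin n) →L[ℝ] ℝ,
      ContDiff ℝ ∞ Φ ∧ ∀ y, chartForm (c • roundMetric n) x y = Φ y := by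
  refine ⟨fun y => c • ((16 / (4 + ‖y‖ ^ 2) ^ 2) •
    (innerSL ℝ : EuclideanSpace ℝ (Fin n) →L[ℝ] EuclideanSpace ℝ (Fin n) →L[ℝ] ℝ)), ?_, ?_⟩
  · exact contDiff_conformalFactor_smul c _
  · intro y
    rw [chartForm_smul, chartForm_roundMetric]

lemma chartMetric_smul_roundMetric {n : ℕ} (c : ℝ) (x : Sph n) :
    chartMetric (stdBasis n) (c • roundMetric n) x
      = blockMetric (stdBasis n) (fun _ => ()) (fun _ => c) := by
  funext y i j
  have h : blockSq (stdBasis n) (fun _ => ()) () y = ‖y‖ ^ 2 := by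
    simp only [blockSq, stdBasis_coord, if_true, EuclideanSpace.real_norm_sq_eq]
  rw [chartMetric_eq_chartForm, chartForm_smul_roundMetric_apply, blockMetric, blockFactor, h]
  simp [stdBasis, EuclideanSpace.inner_single_left, PiLp.single_apply]

lemma isRiemannian_smul_roundMetric {n : ℕ} {c : ℝ} (hc : 0 < c) :
    (c • roundMetric n).IsRiemannian := by
  refine isRiemannian_of_chartForm (fun x => ?_) (fun x u v => ?_)
    fun x => ⟨16 * c / (4 + ‖extChartAt (𝓡 n) x x‖ ^ 2) ^ 2, by positivity, fun u => ?_⟩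
  · obtain ⟨Φ, h1, h2⟩ := exists_contDiff_chartForm_smul_roundMetric c x
    exact ⟨Φ, h1, fun y _ => h2 y⟩
  · rw [chartForm_smul_roundMetric_apply, chartForm_smul_roundMetric_apply, real_inner_comm]
  · rw [chartForm_smul_roundMetric_apply, real_inner_self_eq_norm_sq]

lemma hasConstSectionalCurvature_smul_roundMetric {n : ℕ} {c : ℝ} (hc : c ≠ 0) :
    HasConstSectionalCurvature (stdBasis n) (c • roundMetric n) c⁻¹ := by
  intro p u v
  simp only [chartMetric_smul_roundMetric,
    riemann_blockMetric (stdBasis n) (fun _ => ()) (μ := fun _ => c) (fun _ => hc)]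
  simp only [if_true, blockMetric]
  generalize blockFactor (stdBasis n) (fun _ => ()) (fun _ => c) () (extChartAt (𝓡 n) p p) = F
  have h1 : ∀ a d : Fin n → ℝ, ∑ i, ∑ j, (if i = j then F else 0) * a i * d j
      = F * ∑ i, a i * d i := by
    intro a d
    simp [Finset.mul_sum, mul_assoc]
  have h2 : ∀ i j, ∑ k, ∑ l, c⁻¹ * ((if i = k then F else 0) * (if j = l then F else 0)
      - (if i = l then F else 0) * (if j = k then F else 0)) * u i * v j * u k * v l
      = c⁻¹ * F ^ 2 * ((u i * u i) * (v j * v j) - (u i * v i) * (u j * v j)) := by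
    intro i j
    simp [mul_sub, sub_mul, Finset.sum_sub_distrib]
    ring
  simp only [h1, h2, ← Finset.mul_sum, Finset.sum_sub_distrib, ← Finset.sum_mul]
  ring

end SpaceForms

/-! ### Product metrics on `S² × S⁴` -/

open LocalGeometry

section Product

variable {E H : Type*} [NormedAddCommGroup E] [NormedSpace ℝ E] [TopologicalSpace H]
  {I : ModelWithCorners ℝ E H} {M : Type*} [TopologicalSpace M] [ChartedSpace H M]
  {E' H' : Type*} [NormedAddCommGroup E'] [NormedSpace ℝ E'] [TopologicalSpace H']
  {I' : ModelWithCorners ℝ E' H'} {N : Type*} [TopologicalSpace N] [ChartedSpace H' N]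
  [I.Boundaryless] [IsManifold I 1 M] [I'.Boundaryless] [IsManifold I' 1 N]

lemma chartForm_productMetric (g : BilinField I M) (h : BilinField I' N) {x : M × N} {y : E × E'}
    (hy : y ∈ (extChartAt (I.prod I') x).target) :
    chartForm (productMetric g h) x y
      = pullBilin (chartForm g x.1 y.1) (ContinuousLinearMap.fst ℝ E E')
        + pullBilin (chartForm h x.2 y.2) (ContinuousLinearMap.snd ℝ E E') := by
  have hy1 : y.1 ∈ (extChartAt I x.1).target := by
    rw [extChartAt_prod] at hy; exact hy.1
  have hy2 : y.2 ∈ (extChartAt I' x.2).target := by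
    rw [extChartAt_prod] at hy; exact hy.2
  have hσ := mdifferentiableAt_extChartAt_symm hy
  have e1 : Prod.fst ∘ (extChartAt (I.prod I') x).symm = (extChartAt I x.1).symm ∘ Prod.fst := by
    rw [extChartAt_prod]; rfl
  have e2 : Prod.snd ∘ (extChartAt (I.prod I') x).symm = (extChartAt I' x.2).symm ∘ Prod.snd := by
    rw [extChartAt_prod]; rfl
  have h1 := mfderiv_comp y (I' := I.prod I') (I'' := I) (g := Prod.fst) mdifferentiableAt_fst hσ
  have h2 := mfderiv_comp y (I' := I.prod I') (I'' := I') (g := Prod.snd) mdifferentiableAt_snd hσ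
  rw [e1, mfderiv_comp y (I' := 𝓘(ℝ, E)) (mdifferentiableAt_extChartAt_symm hy1)
    differentiableAt_fst.mdifferentiableAt, mfderiv_eq_fderiv, fderiv_fst] at h1
  rw [e2, mfderiv_comp y (I' := 𝓘(ℝ, E')) (mdifferentiableAt_extChartAt_symm hy2)
    differentiableAt_snd.mdifferentiableAt, mfderiv_eq_fderiv, fderiv_snd] at h2
  let G : M → E →L[ℝ] E →L[ℝ] ℝ := g
  let G' : N → E' →L[ℝ] E' →L[ℝ] ℝ := h
  let A : E →L[ℝ] E := mfderiv 𝓘(ℝ, E) I (extChartAt I x.1).symm y.1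
  let A' : E' →L[ℝ] E' := mfderiv 𝓘(ℝ, E') I' (extChartAt I' x.2).symm y.2
  let B : E × E' →L[ℝ] E :=
    (mfderiv (I.prod I') I Prod.fst ((extChartAt (I.prod I') x).symm y)).comp
    (mfderiv 𝓘(ℝ, E × E') (I.prod I') (extChartAt (I.prod I') x).symm y)
  let B' : E × E' →L[ℝ] E' :=
    (mfderiv (I.prod I') I' Prod.snd ((extChartAt (I.prod I') x).symm y)).comp
      (mfderiv 𝓘(ℝ, E × E') (I.prod I') (extChartAt (I.prod I') x).symm y)
  have hB : A.comp (ContinuousLinearMap.fst ℝ E E') = B := h1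
  have hB' : A'.comp (ContinuousLinearMap.snd ℝ E E') = B' := h2
  have p1 : ((extChartAt (I.prod I') x).symm y).1 = (extChartAt I x.1).symm y.1 := congrFun e1 y
  have p2 : ((extChartAt (I.prod I') x).symm y).2 = (extChartAt I' x.2).symm y.2 := congrFun e2 y
  refine ContinuousLinearMap.ext fun u => ContinuousLinearMap.ext fun w => ?_
  change G ((extChartAt (I.prod I') x).symm y).1 (B u) (B w)
      + G' ((extChartAt (I.prod I') x).symm y).2 (B' u) (B' w)
    = G ((extChartAt I x.1).symm y.1) (A u.1) (A w.1)
      + G' ((extChartAt I' x.2).symm y.2) (A' u.2) (A' w.2)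
  rw [p1, p2, ← hB, ← hB']
  rfl

lemma contDiff_pullBilin {X V W : Type*} [NormedAddCommGroup X] [NormedSpace ℝ X]
    [NormedAddCommGroup V] [NormedSpace ℝ V] [NormedAddCommGroup W] [NormedSpace ℝ W]
    {Φ : X → W →L[ℝ] W →L[ℝ] ℝ} (hΦ : ContDiff ℝ ∞ Φ) (A : V →L[ℝ] W) :
    ContDiff ℝ ∞ (fun y => pullBilin (Φ y) A) := by
  have h : (fun y => pullBilin (Φ y) A)
      = fun y => (ContinuousLinearMap.precomp ℝ A).comp ((Φ y).comp A) := rfl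
  rw [h]
  exact contDiff_const.clm_comp (hΦ.clm_comp contDiff_const)

end Product

section SphereProduct

lemma extChartAt_sphereProduct_target (x : Sph 2 × Sph 4) :
    (extChartAt ((𝓡 2).prod (𝓡 4)) x).target = Set.univ := by
  rw [extChartAt_prod, PartialEquiv.prod_target, extChartAt_sphere_target,
    extChartAt_sphere_target, Set.univ_prod_univ]

/-- The metric `a g₀ + c h₀` on `S² × S⁴`, where `g₀` and `h₀` are the metrics of the unit
spheres. -/
noncomputable def sphereProduct (a c : ℝ) : BilinField ((𝓡 2).prod (𝓡 4)) (Sph 2 × Sph 4) :=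
  productMetric (a • roundMetric 2) (c • roundMetric 4)

lemma chartForm_sphereProduct (a c : ℝ) (x : Sph 2 × Sph 4)
    (y : EuclideanSpace ℝ (Fin 2) × EuclideanSpace ℝ (Fin 4)) :
    chartForm (sphereProduct a c) x y
      = pullBilin (chartForm (a • roundMetric 2) x.1 y.1) (ContinuousLinearMap.fst ℝ _ _)
        + pullBilin (chartForm (c • roundMetric 4) x.2 y.2) (ContinuousLinearMap.snd ℝ _ _) :=
  chartForm_productMetric _ _ (by rw [extChartAt_sphereProduct_target]; trivial)

lemma chartForm_sphereProduct_apply (a c : ℝ) (x : Sph 2 × Sph 4)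
    (y u w : EuclideanSpace ℝ (Fin 2) × EuclideanSpace ℝ (Fin 4)) :
    chartForm (sphereProduct a c) x y u w
      = 16 * a / (4 + ‖y.1‖ ^ 2) ^ 2 * inner ℝ u.1 w.1
        + 16 * c / (4 + ‖y.2‖ ^ 2) ^ 2 * inner ℝ u.2 w.2 := by
  rw [chartForm_sphereProduct, ← chartForm_smul_roundMetric_apply a x.1,
    ← chartForm_smul_roundMetric_apply c x.2]
  rfl

lemma exists_contDiff_chartForm_sphereProduct (a c : ℝ) (x : Sph 2 × Sph 4) :
    ∃ Φ : EuclideanSpace ℝ (Fin 2) × EuclideanSpace ℝ (Fin 4) →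
        EuclideanSpace ℝ (Fin 2) × EuclideanSpace ℝ (Fin 4) →L[ℝ]
          EuclideanSpace ℝ (Fin 2) × EuclideanSpace ℝ (Fin 4) →L[ℝ] ℝ,
      ContDiff ℝ ∞ Φ ∧ ∀ y, chartForm (sphereProduct a c) x y = Φ y := by
  obtain ⟨Φ, h1, h2⟩ := exists_contDiff_chartForm_smul_roundMetric a x.1
  obtain ⟨Ψ, h3, h4⟩ := exists_contDiff_chartForm_smul_roundMetric c x.2
  refine ⟨fun y => pullBilin (Φ y.1) (ContinuousLinearMap.fst ℝ _ _)
    + pullBilin (Ψ y.2) (ContinuousLinearMap.snd ℝ _ _), ?_, fun y => ?_⟩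
  · exact (contDiff_pullBilin (h1.comp contDiff_fst) _).add
      (contDiff_pullBilin (h3.comp contDiff_snd) _)
  · rw [chartForm_sphereProduct, h2, h4]

lemma isSmooth_sphereProduct (a c : ℝ) : (sphereProduct a c).IsSmooth :=
  isSmooth_of_chartForm fun x => by
    obtain ⟨Φ, h1, h2⟩ := exists_contDiff_chartForm_sphereProduct a c x
    exact ⟨Φ, h1, fun y _ => h2 y⟩

lemma sphereProduct_symm (a c : ℝ) (p : Sph 2 × Sph 4)
    (u w : TangentSpace ((𝓡 2).prod (𝓡 4)) p) :
    sphereProduct a c p u w = sphereProduct a c p w u := by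
  have h : ∀ u w, chartForm (sphereProduct a c) p (extChartAt ((𝓡 2).prod (𝓡 4)) p p) u w
      = chartForm (sphereProduct a c) p (extChartAt ((𝓡 2).prod (𝓡 4)) p p) w u := by
    intro u w
    rw [chartForm_sphereProduct_apply, chartForm_sphereProduct_apply, real_inner_comm w.1,
      real_inner_comm w.2]
  rw [chartForm_self] at h
  exact h u w

lemma isRiemannian_sphereProduct {a c : ℝ} (ha : 0 < a) (hc : 0 < c) :
    (sphereProduct a c).IsRiemannian := by
  refine isRiemannian_of_chartForm (fun x => ?_) (fun x u w => ?_) fun x => ?_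
  · obtain ⟨Φ, h1, h2⟩ := exists_contDiff_chartForm_sphereProduct a c x
    exact ⟨Φ, h1, fun y _ => h2 y⟩
  · rw [chartForm_sphereProduct_apply, chartForm_sphereProduct_apply, real_inner_comm w.1,
      real_inner_comm w.2]
  · generalize extChartAt ((𝓡 2).prod (𝓡 4)) x x = y
    have ha' : 0 < 16 * a / (4 + ‖y.1‖ ^ 2) ^ 2 := by positivity
    have hc' : 0 < 16 * c / (4 + ‖y.2‖ ^ 2) ^ 2 := by positivity
    -- The model space carries the supremum norm, so each factor is estimated by itself.
    refine ⟨min _ _, lt_min ha' hc', fun u => ?_⟩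
    rw [chartForm_sphereProduct_apply, real_inner_self_eq_norm_sq, real_inner_self_eq_norm_sq]
    rcases max_choice ‖u.1‖ ‖u.2‖ with h | h
    · rw [Prod.norm_def, h]
      have h1 := mul_le_mul_of_nonneg_right (min_le_left (16 * a / (4 + ‖y.1‖ ^ 2) ^ 2)
        (16 * c / (4 + ‖y.2‖ ^ 2) ^ 2)) (sq_nonneg ‖u.1‖)
      nlinarith [mul_nonneg hc'.le (sq_nonneg ‖u.2‖)]
    · rw [Prod.norm_def, h]
      have h1 := mul_le_mul_of_nonneg_right (min_le_right (16 * a / (4 + ‖y.1‖ ^ 2) ^ 2)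
        (16 * c / (4 + ‖y.2‖ ^ 2) ^ 2)) (sq_nonneg ‖u.2‖)
      nlinarith [mul_nonneg ha'.le (sq_nonneg ‖u.1‖)]

/-- The scales of the two blocks of coordinates on `S² × S⁴`; `true` stands for `S²`. -/
def blockScale (a c : ℝ) (t : Bool) : ℝ := if t then a else c

lemma blockScale_ne_zero {a c : ℝ} (ha : a ≠ 0) (hc : c ≠ 0) (t : Bool) :
    blockScale a c t ≠ 0 := by
  cases t <;> simpa [blockScale]

lemma blockSq_stdBasis24 (y : EuclideanSpace ℝ (Fin 2) × EuclideanSpace ℝ (Fin 4)) :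
    blockSq stdBasis24 Sum.isLeft true y = ‖y.1‖ ^ 2 ∧
      blockSq stdBasis24 Sum.isLeft false y = ‖y.2‖ ^ 2 := by
  constructor <;>
    simp [blockSq, stdBasis24, stdBasis, EuclideanSpace.real_norm_sq_eq]

lemma chartMetric_sphereProduct (a c : ℝ) (x : Sph 2 × Sph 4) :
    chartMetric stdBasis24 (sphereProduct a c) x
      = blockMetric stdBasis24 Sum.isLeft (blockScale a c) := by
  funext y i j
  rw [chartMetric_eq_chartForm, chartForm_sphereProduct_apply, blockMetric, blockFactor]
  rcases i with i | i <;> rcases j with j | j <;>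
    simp only [Sum.isLeft_inl, Sum.isLeft_inr, (blockSq_stdBasis24 y).1,
      (blockSq_stdBasis24 y).2] <;>
    simp [stdBasis24, stdBasis, EuclideanSpace.inner_single_left, PiLp.single_apply, blockScale]

end SphereProduct

/-! ### The volume and the functional `𝓛₁` on `S² × S⁴` -/

section TotalVolume

lemma stdBasis24_addHaar : stdBasis24.addHaar
    = (volume : Measure (EuclideanSpace ℝ (Fin 2))).prod
      (volume : Measure (EuclideanSpace ℝ (Fin 4))) := by
  rw [stdBasis24, Module.Basis.prod_addHaar, stdBasis, stdBasis,
    OrthonormalBasis.addHaar_eq_volume, OrthonormalBasis.addHaar_eq_volume]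

lemma subsingleton_preimage_extChartAt_symm {n : ℕ} (x x' : Sph n) :
    ((extChartAt (𝓡 n) x).symm ⁻¹' (extChartAt (𝓡 n) x').sourceᶜ).Subsingleton := by
  intro y hy z hz
  rw [extChartAt_sphere_source, compl_compl] at hy hz
  have h : (extChartAt (𝓡 n) x).symm y = (extChartAt (𝓡 n) x).symm z :=
    (Set.mem_singleton_iff.mp hy).trans (Set.mem_singleton_iff.mp hz).symm
  have hT : ∀ w, w ∈ (extChartAt (𝓡 n) x).target := fun w => by
    rw [extChartAt_sphere_target]; trivial
  exact (extChartAt (𝓡 n) x).symm.injOn (hT y) (hT z) h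

/-- Each product chart misses only a null set. -/
lemma addHaar_preimage_compl_source (x x' : Sph 2 × Sph 4) :
    stdBasis24.addHaar ((extChartAt ((𝓡 2).prod (𝓡 4)) x).symm ⁻¹'
      (extChartAt ((𝓡 2).prod (𝓡 4)) x').sourceᶜ) = 0 := by
  rw [stdBasis24_addHaar]
  have h1 := (subsingleton_preimage_extChartAt_symm x.1 x'.1).measure_zero
    (volume : Measure (EuclideanSpace ℝ (Fin 2)))
  have h2 := (subsingleton_preimage_extChartAt_symm x.2 x'.2).measure_zero
    (volume : Measure (EuclideanSpace ℝ (Fin 4)))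
  refine measure_mono_null (t := (_ ×ˢ Set.univ) ∪ (Set.univ ×ˢ _)) ?_
    (measure_union_null (by rw [Measure.prod_prod, h1, zero_mul])
      (by rw [Measure.prod_prod, h2, mul_zero]))
  intro y hy
  rw [extChartAt_prod, extChartAt_prod] at hy
  by_contra hn
  simp only [Set.mem_union, Set.mem_prod, Set.mem_univ, and_true, true_and, not_or,
    Set.mem_preimage, Set.mem_compl_iff, not_not] at hn
  exact hy hn

lemma volumeMeasure_sphereProduct_univ {a c : ℝ} (ha : 0 < a) (hc : 0 < c) :
    volumeMeasure stdBasis24 (sphereProduct a c) Set.univ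
      = ENNReal.ofReal (32 / 3 * Real.pi ^ 3 * a * c ^ 2) := by
  obtain ⟨x⟩ : Nonempty (Sph 2 × Sph 4) := ⟨⟨EuclideanSpace.single 0 1, by simp⟩,
    ⟨EuclideanSpace.single 0 1, by simp⟩⟩
  rw [volumeMeasure_eq_chartVolume stdBasis24 _ extChartAt_sphereProduct_target
    addHaar_preimage_compl_source x, chartVolume_apply _ _ (extChartAt_sphereProduct_target x)
    MeasurableSet.univ, Set.preimage_univ, setLIntegral_univ]
  have h : ∀ y : EuclideanSpace ℝ (Fin 2) × EuclideanSpace ℝ (Fin 4),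
      ENNReal.ofReal (Real.sqrt
        (Matrix.of (chartMetric stdBasis24 (sphereProduct a c) x y)).det)
      = ENNReal.ofReal (16 * a / (4 + ‖y.1‖ ^ 2) ^ 2)
        * ENNReal.ofReal ((16 * c / (4 + ‖y.2‖ ^ 2) ^ 2) ^ 2) := by
    intro y
    have h1 : Matrix.of (blockMetric stdBasis24 Sum.isLeft (blockScale a c) y)
        = Matrix.diagonal fun i => blockFactor stdBasis24 Sum.isLeft (blockScale a c)
            (Sum.isLeft i) y := by
      ext i j
      simp [blockMetric, Matrix.diagonal_apply]
    rw [← ENNReal.ofReal_mul (by positivity), chartMetric_sphereProduct, h1, Matrix.det_diagonal,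
      Fintype.prod_sum_type]
    simp only [Sum.isLeft_inl, Sum.isLeft_inr, blockFactor, (blockSq_stdBasis24 y).1,
      (blockSq_stdBasis24 y).2, blockScale, Finset.prod_const, Finset.card_univ, Fintype.card_fin,
      if_true, Bool.false_eq_true, if_false]
    congr 1
    rw [← Real.sqrt_sq (by positivity : 0 ≤ 16 * a / (4 + ‖y.1‖ ^ 2) ^ 2
      * (16 * c / (4 + ‖y.2‖ ^ 2) ^ 2) ^ 2)]
    congr 1
    ring
  simp only [h, stdBasis24_addHaar]
  rw [lintegral_prod_mul
    (f := fun y : EuclideanSpace ℝ (Fin 2) => ENNReal.ofReal (16 * a / (4 + ‖y‖ ^ 2) ^ 2))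
    (g := fun y : EuclideanSpace ℝ (Fin 4) => ENNReal.ofReal ((16 * c / (4 + ‖y‖ ^ 2) ^ 2) ^ 2))
    (by fun_prop) (by fun_prop), lintegral_stereographic_two a ha.le,
    lintegral_stereographic_four, ← ENNReal.ofReal_mul (by positivity)]
  congr 1
  ring

end TotalVolume

section Values

lemma sum_ite_ne {n : ℕ} (i : Fin (n + 1)) (x : ℝ) :
    ∑ j : Fin (n + 1), (if j = i then 0 else x) = n * x := by
  rw [Finset.sum_ite]
  simp [Finset.filter_ne', Finset.card_erase_of_mem]

lemma L1Density_sphereProduct {c : ℝ} (hc : 0 < c) (p : Sph 2 × Sph 4) :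
    L1Density stdBasis24 (sphereProduct (1 / 3) c) p
      = 36 * (3 * c + 1) ^ 2 * (c - 1) / c ^ 3 := by
  have hμ := blockScale_ne_zero (a := 1 / 3) (c := c) (by norm_num) hc.ne'
  have hr1 : blockRicci Sum.isLeft (blockScale (1 / 3) c) true (ι := Fin 2 ⊕ Fin 4) = 3 := by
    norm_num [blockRicci, blockScale, Fintype.sum_sum_type, -Finset.sum_boole]
  have hr2 : blockRicci Sum.isLeft (blockScale (1 / 3) c) false (ι := Fin 2 ⊕ Fin 4)
      = 3 * c⁻¹ := by
    norm_num [blockRicci, blockScale, Fintype.sum_sum_type, -Finset.sum_boole]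
    ring
  have hJ : blockJ Sum.isLeft (blockScale (1 / 3) c) (ι := Fin 2 ⊕ Fin 4)
      = (3 + 6 * c⁻¹) / 5 := by
    norm_num [blockJ, Fintype.sum_sum_type, hr1, hr2]
    ring
  have hp1 : blockSchouten Sum.isLeft (blockScale (1 / 3) c) true (ι := Fin 2 ⊕ Fin 4)
      = (6 - 3 * c⁻¹) / 10 := by
    norm_num [blockSchouten, hJ, hr1]
    ring
  have hp2 : blockSchouten Sum.isLeft (blockScale (1 / 3) c) false (ι := Fin 2 ⊕ Fin 4)
      = (9 * c⁻¹ - 3) / 20 := by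
    norm_num [blockSchouten, hJ, hr2]
    ring
  -- The three sectional values of the Weyl tensor are in the ratio `1 : -1/4 : 1/6`.
  have hw11 : blockWeyl Sum.isLeft (blockScale (1 / 3) c) true true (ι := Fin 2 ⊕ Fin 4)
      = 3 * (3 + c⁻¹) / 5 := by
    norm_num [blockWeyl, hp1, blockScale]
    ring
  have hw12 : blockWeyl Sum.isLeft (blockScale (1 / 3) c) true false (ι := Fin 2 ⊕ Fin 4)
      = -3 * (3 + c⁻¹) / 20 := by
    norm_num [blockWeyl, hp1, hp2]
    ring
  have hw21 : blockWeyl Sum.isLeft (blockScale (1 / 3) c) false true (ι := Fin 2 ⊕ Fin 4)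
      = -3 * (3 + c⁻¹) / 20 := by
    norm_num [blockWeyl, hp1, hp2]
    ring
  have hw22 : blockWeyl Sum.isLeft (blockScale (1 / 3) c) false false (ι := Fin 2 ⊕ Fin 4)
      = (3 + c⁻¹) / 10 := by
    norm_num [blockWeyl, hp2, blockScale]
    ring
  have hq1 : ∀ i : Fin 2, blockWeylSq Sum.isLeft (blockScale (1 / 3) c) (Sum.inl i : Fin 2 ⊕ Fin 4)
      = 9 * (3 + c⁻¹) ^ 2 / 20 := by
    intro i
    simp only [blockWeylSq, Fintype.sum_sum_type, Sum.isLeft_inl, Sum.isLeft_inr, hw11, hw12,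
      Sum.inl.injEq, sum_ite_ne]
    simp
    ring
  have hq2 : ∀ i : Fin 4, blockWeylSq Sum.isLeft (blockScale (1 / 3) c) (Sum.inr i : Fin 2 ⊕ Fin 4)
      = 3 * (3 + c⁻¹) ^ 2 / 40 := by
    intro i
    simp only [blockWeylSq, Fintype.sum_sum_type, Sum.isLeft_inl, Sum.isLeft_inr, hw21, hw22,
      Sum.inr.injEq, sum_ite_ne]
    simp
    ring
  rw [L1Density, chartMetric_sphereProduct, L1_blockMetric _ _ hμ]
  simp only [Fintype.sum_sum_type, Sum.isLeft_inl, Sum.isLeft_inr, hq1, hq2, hp1, hp2, hJ,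
    Finset.sum_const, Finset.card_univ, Fintype.card_fin, nsmul_eq_mul]
  field_simp
  ring

lemma L1Functional_sphereProduct {c : ℝ} (hc : 0 < c) :
    Integrable (L1Density stdBasis24 (sphereProduct (1 / 3) c))
        (volumeMeasure stdBasis24 (sphereProduct (1 / 3) c)) ∧
      L1Functional stdBasis24 (sphereProduct (1 / 3) c)
        = 128 * Real.pi ^ 3 * c⁻¹ * (3 * c + 1) ^ 2 * (c - 1) := by
  have hd : L1Density stdBasis24 (sphereProduct (1 / 3) c)
      = fun _ => 36 * (3 * c + 1) ^ 2 * (c - 1) / c ^ 3 :=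
    funext fun p => L1Density_sphereProduct hc p
  have hv := volumeMeasure_sphereProduct_univ (a := 1 / 3) (by norm_num) hc
  have hfin : IsFiniteMeasure (volumeMeasure stdBasis24 (sphereProduct (1 / 3) c)) :=
    ⟨by rw [hv]; exact ENNReal.ofReal_lt_top⟩
  rw [L1Functional, hd]
  refine ⟨integrable_const _, ?_⟩
  rw [integral_const, Measure.real, hv, ENNReal.toReal_ofReal (by positivity), smul_eq_mul]
  field_simp
  ring

/-- The Ricci curvatures of the factors are `a⁻¹` and `3 c⁻¹`. -/
lemma isEinstein_sphereProduct {a c : ℝ} (ha : a ≠ 0) (hc : c ≠ 0) (hac : a⁻¹ = 3 * c⁻¹) :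
    IsEinstein stdBasis24 (sphereProduct a c) := by
  refine ⟨3 * c⁻¹, fun p i j => ?_⟩
  rw [chartMetric_sphereProduct, ricci_blockMetric _ _ (blockScale_ne_zero ha hc)]
  congr 1
  rcases i with i | i <;> simp [-Finset.sum_boole, blockRicci, blockScale,
    Fintype.sum_sum_type, hac]
  all_goals norm_num
  ring

/-- The first variation of `𝓛₁` at `g + h` in the direction of `h` is the derivative at `c = 1` of
`c ↦ 𝓛₁(g + c h)`, which is `2048 π³`. -/
lemma not_isCriticalMetric_sphereProduct :
    ¬ IsCriticalMetric (L1Functional stdBasis24) (sphereProduct (1 / 3) 1) := by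
  intro h
  have h1 := h (sphereProduct 0 1) (isSmooth_sphereProduct 0 1) (sphereProduct_symm 0 1)
  have h2 : ∀ t : ℝ, sphereProduct (1 / 3) 1 + t • sphereProduct 0 1
      = sphereProduct (1 / 3) (1 + t) := by
    intro t
    funext p
    refine ContinuousLinearMap.ext fun u => ContinuousLinearMap.ext fun w => ?_
    obtain ⟨r, s, hrs⟩ : ∃ r s : ℝ, ∀ a c, sphereProduct a c p u w = a * r + c * s :=
      ⟨_, _, fun _ _ => rfl⟩
    change sphereProduct (1 / 3) 1 p u w + t * sphereProduct 0 1 p u w = _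
    rw [hrs, hrs, hrs]
    ring
  simp only [h2] at h1
  have h3 : (fun t : ℝ => L1Functional stdBasis24 (sphereProduct (1 / 3) (1 + t)))
      =ᶠ[nhds 0] fun t => 128 * Real.pi ^ 3 * ((1 + t)⁻¹ * (3 * (1 + t) + 1) ^ 2) * t := by
    filter_upwards [lt_mem_nhds (show (-1 : ℝ) < 0 by norm_num)] with t ht
    rw [(L1Functional_sphereProduct (by linarith : 0 < 1 + t)).2]
    ring
  have h4 : HasDerivAt
      (fun t : ℝ => 128 * Real.pi ^ 3 * ((1 + t)⁻¹ * (3 * (1 + t) + 1) ^ 2) * t)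
      (2048 * Real.pi ^ 3) 0 := by
    have e1 : HasDerivAt (fun t : ℝ => 1 + t) 1 0 := (hasDerivAt_id 0).const_add 1
    have e2 := ((e1.fun_inv (by norm_num)).fun_mul
      (((e1.const_mul 3).add_const 1).fun_pow 2)).const_mul (128 * Real.pi ^ 3)
    refine (e2.fun_mul (hasDerivAt_id (0 : ℝ))).congr_deriv ?_
    norm_num
    ring
  rw [h3.deriv_eq, h4.deriv] at h1
  exact absurd h1 (by positivity)

end Values

end RiemGeometry

theorem proposition5p3 :
    -- `g` and `h` are Riemannian metrics of constant sectional curvature `3` and `1`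
    (RiemGeometry.metricS2.IsRiemannian ∧
      RiemGeometry.HasConstSectionalCurvature (RiemGeometry.stdBasis 2)
        RiemGeometry.metricS2 3) ∧
    (RiemGeometry.metricS4.IsRiemannian ∧
      RiemGeometry.HasConstSectionalCurvature (RiemGeometry.stdBasis 4)
        RiemGeometry.metricS4 1) ∧
    -- the value of the functional at the metrics `g + c h`
    (∀ c : ℝ, 0 < c →
      (RiemGeometry.productMetric RiemGeometry.metricS2
        (c • RiemGeometry.metricS4)).IsRiemannian ∧
      MeasureTheory.Integrable
        (RiemGeometry.L1Density RiemGeometry.stdBasis24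
          (RiemGeometry.productMetric RiemGeometry.metricS2 (c • RiemGeometry.metricS4)))
        (RiemGeometry.volumeMeasure RiemGeometry.stdBasis24
          (RiemGeometry.productMetric RiemGeometry.metricS2 (c • RiemGeometry.metricS4))) ∧
      RiemGeometry.L1Functional RiemGeometry.stdBasis24
          (RiemGeometry.productMetric RiemGeometry.metricS2 (c • RiemGeometry.metricS4))
        = 128 * Real.pi ^ 3 * c⁻¹ * (3 * c + 1) ^ 2 * (c - 1)) ∧
    -- `g + h` is Einstein
    RiemGeometry.IsEinstein RiemGeometry.stdBasis24
      (RiemGeometry.productMetric RiemGeometry.metricS2 RiemGeometry.metricS4) ∧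
    -- `g + h` is not a critical point
    ¬ RiemGeometry.IsCriticalMetric
      (RiemGeometry.L1Functional RiemGeometry.stdBasis24)
      (RiemGeometry.productMetric RiemGeometry.metricS2 RiemGeometry.metricS4) := by
  have hS2 : RiemGeometry.metricS2 = (1 / 3 : ℝ) • RiemGeometry.roundMetric 2 := rfl
  have hS4 : RiemGeometry.metricS4 = (1 : ℝ) • RiemGeometry.roundMetric 4 := (one_smul ℝ _).symm
  have hprod : ∀ c : ℝ, RiemGeometry.productMetric RiemGeometry.metricS2
      (c • RiemGeometry.metricS4) = RiemGeometry.sphereProduct (1 / 3) c := fun _ => rfl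
  have hprod1 : RiemGeometry.productMetric RiemGeometry.metricS2 RiemGeometry.metricS4
      = RiemGeometry.sphereProduct (1 / 3) 1 := by
    rw [← hprod, one_smul]
  have h3 := RiemGeometry.hasConstSectionalCurvature_smul_roundMetric (n := 2) (c := 1 / 3)
    (by norm_num)
  have h1 := RiemGeometry.hasConstSectionalCurvature_smul_roundMetric (n := 4) (c := 1)
    one_ne_zero
  rw [one_div, inv_inv, ← one_div] at h3
  rw [inv_one] at h1
  refine ⟨⟨RiemGeometry.isRiemannian_smul_roundMetric (by norm_num), h3⟩, ⟨?_, ?_⟩,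
    fun c hc => ?_, ?_, ?_⟩
  · rw [hS4]
    exact RiemGeometry.isRiemannian_smul_roundMetric one_pos
  · rw [hS4]
    exact h1
  · rw [hprod]
    exact ⟨RiemGeometry.isRiemannian_sphereProduct (by norm_num) hc,
      RiemGeometry.L1Functional_sphereProduct hc⟩
  · rw [hprod1]
    exact RiemGeometry.isEinstein_sphereProduct (by norm_num) one_ne_zero (by norm_num)
  · rw [hprod1]
    exact RiemGeometry.not_isCriticalMetric_sphereProduct
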